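/- All trees are finite and unlabeled, i.e. counted up to isomorphism. A tree is $k$-valent if every node has degree at most $k$. A tree of even diameter $2m$ is called centered: it has a unique node (its center) that is the midpoint of every path of length $2m$. A tree of odd diameter $2m+1$ is called bicentered: it has a unique unordered pair of nodes (its bicenters) that are the two middle nodes of every path of length $2m+1$. Let $C_n$, $B_n$ and $A_n$ be the numbers of centered 4-valent trees, bicentered 4-valent trees, and all 4-valent trees (alkanes) with $n$ nodes. Then, for $n=1,\dots,22$: $(C_n)$ = 1, 0, 1, 1, 2, 2, 6, 9, 20, 37, 86, 181, 422, 943, 2223, 5225, 12613, 30513, 74883, 184484, 458561, 1145406; $(B_n)$ = 0, 1, 0, 1, 1, 3, 3, 9, 15, 38, 73, 174, 380, 915, 2124, 5134, 12281, 30010, 73401, 181835, 452165, 1133252; $(A_n)$ = 1, 1, 1, 2, 3, 5, 9, 18, 35, 75, 159, 355, 802, 1858, 4347, 10359, 24894, 60523, 148284, 366319, 910726, 2278658. Consequently, in Cayley's 1875 table for $n=1,\dots,13$, namely centered: 1, 0, 1, 1, 2, 2, 6, 9, 20, 37, 86, 183, 419; bicentered: 0, 1, 0, 1, 1, 3, 3,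 9, 15, 38, 73, 174, 380; total: 1, 1, 1, 2, 3, 5, 9, 18, 35, 75, 159, 357, 799, the entries in the centered and total rows are correct exactly for $n\neq 12,13$, and all entries of the bicentered row are correct. The value $147284$ given by Henze and Blair for $A_{19}$ is incorrect; the correct value is $A_{19}=148284$. -/

import Mathlib

namespace AlkaneCount

/-- A graph is `k`-valent if every node has degree at most `k`. -/
def IsKValent {V : Type*} (k : ℕ) (G : SimpleGraph V) : Prop :=
  ∀ v : V, (G.neighborSet v).encard ≤ k

/-- `c` is the midpoint of every path of length `2 * m` in `G`. -/
def IsMidpoint {V : Type*} (G : SimpleGraph V) (m : ℕ) (c : V) : Prop :=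
  ∀ (u v : V) (p : G.Walk u v), p.IsPath → p.length = 2 * m → p.getVert m = c

/-- The unordered pair `e` consists of the two middle nodes of every path of length
`2 * m + 1` in `G`. -/
def IsMiddlePair {V : Type*} (G : SimpleGraph V) (m : ℕ) (e : Sym2 V) : Prop :=
  ∀ (u v : V) (p : G.Walk u v), p.IsPath → p.length = 2 * m + 1 →
    s(p.getVert m, p.getVert (m + 1)) = e

/-- A centered tree: its diameter is an even number `2 * m`, and it has a center, i.e. a unique
node at the midpoint of every path of length `2 * m`. -/
def IsCenteredTree {V : Type*} (G : SimpleGraph V) : Prop :=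
  G.IsTree ∧ ∃ m : ℕ, G.diam = 2 * m ∧ ∃! c : V, IsMidpoint G m c

/-- A bicentered tree: its diameter is an odd number `2 * m + 1`, and it has bicenters, i.e. a
unique pair of nodes at the middle of every path of length `2 * m + 1`. -/
def IsBicenteredTree {V : Type*} (G : SimpleGraph V) : Prop :=
  G.IsTree ∧ ∃ m : ℕ, G.diam = 2 * m + 1 ∧ ∃! e : Sym2 V, IsMiddlePair G m e

/-- Isomorphism of graphs on the node set `Fin n`. -/
def isoSetoid (n : ℕ) : Setoid (SimpleGraph (Fin n)) where
  r G H := Nonempty (G ≃g H)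
  iseqv :=
    { refl := fun _ => ⟨SimpleGraph.Iso.refl⟩
      symm := fun ⟨f⟩ => ⟨f.symm⟩
      trans := fun ⟨f⟩ ⟨g⟩ => ⟨f.trans g⟩ }

/-- An unlabeled graph with `n` nodes: an isomorphism class of graphs on `Fin n`. -/
abbrev UnlabeledGraph (n : ℕ) : Type := Quotient (isoSetoid n)

/-- The number of unlabeled graphs with `n` nodes that have the property `P`. -/
noncomputable def numUnlabeled (n : ℕ) (P : SimpleGraph (Fin n) → Prop) : ℕ :=
  {q : UnlabeledGraph n | ∃ G : SimpleGraph (Fin n), Quotient.mk (isoSetoid n) G = q ∧ P G}.ncard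

/-- The number of centered `k`-valent (unlabeled) trees with `n` nodes. -/
noncomputable def numCentered (k n : ℕ) : ℕ :=
  numUnlabeled n fun G => IsCenteredTree G ∧ IsKValent k G

/-- The number of bicentered `k`-valent (unlabeled) trees with `n` nodes. -/
noncomputable def numBicentered (k n : ℕ) : ℕ :=
  numUnlabeled n fun G => IsBicenteredTree G ∧ IsKValent k G

/-- The number of all `k`-valent (unlabeled) trees with `n` nodes. -/
noncomputable def numTrees (k n : ℕ) : ℕ :=
  numUnlabeled n fun G => G.IsTree ∧ IsKValent k G

/-- Cayley's 1875 entries for centered 4-valent trees, `n = 1, …, 13` (entry `n` has list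
position `n - 1`). -/
def cayleyCentered : List ℕ := [1, 0, 1, 1, 2, 2, 6, 9, 20, 37, 86, 183, 419]

/-- Cayley's 1875 entries for bicentered 4-valent trees, `n = 1, …, 13`. -/
def cayleyBicentered : List ℕ := [0, 1, 0, 1, 1, 3, 3, 9, 15, 38, 73, 174, 380]

/-- Cayley's 1875 entries for all 4-valent trees, `n = 1, …, 13`. -/
def cayleyTotal : List ℕ := [1, 1, 1, 2, 3, 5, 9, 18, 35, 75, 159, 357, 799]

/-- The value published by Henze and Blair in 1931 for all 4-valent trees with 19 nodes. -/
def henzeBlair19 : ℕ := 147284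

end AlkaneCount

namespace AlkaneCount

/-- Rooted unordered trees of height at most `h`. -/
def RTree : ℕ → Type
  | 0 => Unit
  | h + 1 => Multiset (RTree h)

namespace RTree

/-- The only rooted tree of height `0`. -/
def leaf : RTree 0 := ()

/-- The rooted tree whose root has the given multiset of branches. -/
def node {h : ℕ} (s : Multiset (RTree h)) : RTree (h + 1) := s

/-- The branches at the root. -/
def branches {h : ℕ} (x : RTree (h + 1)) : Multiset (RTree h) := x

@[simp] theorem branches_node {h : ℕ} (s : Multiset (RTree h)) : (node s).branches = s := rfl

@[simp] theorem node_branches {h : ℕ} (x : RTree (h + 1)) : node x.branches = x := rfl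

theorem node_injective {h : ℕ} : Function.Injective (node (h := h)) := fun _ _ e => e

/-- The number of nodes. -/
def size : {h : ℕ} → RTree h → ℕ
  | 0, _ => 1
  | _ + 1, x => 1 + (x.branches.map size).sum

end RTree

/-- A rooted forest: every node of positive depth has a parent that is one level closer to
the roots, which are the nodes of depth `0`. -/
structure Forest (V : Type) where
  /-- the parent of a node (irrelevant for roots) -/
  par : V → V
  /-- the depth of a node -/
  dep : V → ℕ
  dep_par : ∀ v, dep v ≠ 0 → dep (par v) + 1 = dep v

namespace Forest

section

variable {V : Type} [Fintype V] (F : Forest V)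

open Classical in
/-- The nodes with parent `v`. -/
noncomputable def children (v : V) : Finset V := {w | F.dep w ≠ 0 ∧ F.par w = v}

open Classical in
/-- The nodes at depth `k`. -/
noncomputable def level (k : ℕ) : Finset V := {w | F.dep w = k}

@[simp] theorem mem_children {v w : V} : w ∈ F.children v ↔ F.dep w ≠ 0 ∧ F.par w = v := by
  simp [children]

@[simp] theorem mem_level {k : ℕ} {w : V} : w ∈ F.level k ↔ F.dep w = k := by
  simp [level]

/-- The isomorphism type of the branch at `v`, cut off at relative height `h`. -/
noncomputable def code : (h : ℕ) → V → RTree h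
  | 0, _ => RTree.leaf
  | h + 1, v => RTree.node ((F.children v).val.map (code h))

/-- The isomorphism types of the components, cut off at height `m`. -/
noncomputable def rootCodes (m : ℕ) : Multiset (RTree m) := (F.level 0).val.map (F.code m)

theorem code_succ (h : ℕ) (v : V) :
    F.code (h + 1) v = RTree.node ((F.children v).val.map (F.code h)) := rfl

theorem dep_of_mem_children {v w : V} (h : w ∈ F.children v) : F.dep w = F.dep v + 1 := by
  rw [mem_children] at h
  have := F.dep_par w h.1
  rw [h.2] at this
  exact this.symm

end

section Iso

variable {V V' : Type} [Fintype V] [Fintype V'] {F : Forest V} {F' : Forest V'}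

theorem exists_equiv_of_map_eq {A B C : Type*} [Fintype A] [Fintype B] (f : A → C) (g : B → C)
    (h : (Finset.univ : Finset A).val.map f = (Finset.univ : Finset B).val.map g) :
    ∃ e : A ≃ B, ∀ a, g (e a) = f a := by
  classical
  have key : ∀ c, Nonempty ({a // f a = c} ≃ {b // g b = c}) := by
    intro c
    rw [← Fintype.card_eq, Fintype.card_subtype, Fintype.card_subtype]
    have := congrArg (Multiset.count c) h
    rw [Multiset.count_map, Multiset.count_map] at this
    simp only [Finset.card, Finset.filter_val]
    simpa only [eq_comm] using this
  exact ⟨Equiv.ofFiberEquiv fun c => (key c).some, fun a => Equiv.ofFiberEquiv_map _ a⟩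

theorem map_children_eq_of_code_eq {j j' : ℕ} (hj : j = j' + 1) {v : V} {v' : V'}
    (h : F.code j v = F'.code j v') :
    (F.children v).val.map (F.code j') = (F'.children v').val.map (F'.code j') := by
  subst hj
  exact RTree.node_injective h

/-- Nodes at depth `k + 1`, sorted by their parents. -/
noncomputable def levelSuccEquiv (F : Forest V) (k : ℕ) :
    {v // F.dep v = k + 1} ≃ Σ v : {v // F.dep v = k}, {w // w ∈ F.children v} where
  toFun v := ⟨⟨F.par v, by have := F.dep_par v; have := v.2; omega⟩, v,
    (F.mem_children).2 ⟨by have := v.2; omega, rfl⟩⟩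
  invFun s := ⟨s.2, by rw [F.dep_of_mem_children s.2.2, s.1.2]⟩
  left_inv _ := rfl
  right_inv := by
    rintro ⟨⟨v, hv⟩, w, hw⟩
    obtain ⟨h1, rfl⟩ := F.mem_children.1 hw
    rfl

/-- A bijection between corresponding levels that respects codes extends to the next level. -/
theorem exists_next_level {m : ℕ} (hF : ∀ v, F.dep v ≤ m) (hF' : ∀ v, F'.dep v ≤ m) (k : ℕ)
    (e : {v // F.dep v = k} ≃ {v // F'.dep v = k})
    (he : ∀ v, F'.code (m - k) (e v) = F.code (m - k) v) :
    ∃ e' : {v // F.dep v = k + 1} ≃ {v // F'.dep v = k + 1},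
      (∀ v, F'.code (m - (k + 1)) (e' v) = F.code (m - (k + 1)) v) ∧
      ∀ v (hv : F.dep (F.par v) = k) (hv' : F.dep v = k + 1),
        F'.par (e' ⟨v, hv'⟩) = e ⟨F.par v, hv⟩ := by
  classical
  by_cases hk : k < m
  · have hj : m - k = (m - (k + 1)) + 1 := by omega
    have key : ∀ v : {v // F.dep v = k},
        ∃ f : {w // w ∈ F.children v} ≃ {w // w ∈ F'.children (e v)},
          ∀ w, F'.code (m - (k + 1)) (f w) = F.code (m - (k + 1)) w := by
      intro v
      have h1 := map_children_eq_of_code_eq hj (he v)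
      apply exists_equiv_of_map_eq
        (fun w : {w // w ∈ F.children v} => F.code (m - (k + 1)) w)
        (fun w : {w // w ∈ F'.children (e v)} => F'.code (m - (k + 1)) w)
      have a1 := Multiset.attach_map_val' (F.children v).val (F.code (m - (k + 1)))
      have a2 := Multiset.attach_map_val' (F'.children (e v)).val (F'.code (m - (k + 1)))
      rw [Finset.univ_eq_attach, Finset.univ_eq_attach, Finset.attach_val, Finset.attach_val]
      exact a1.trans (h1.symm.trans a2.symm)
    choose f hf using key
    refine ⟨(F.levelSuccEquiv k).trans ((Equiv.sigmaCongr e f).trans (F'.levelSuccEquiv k).symm),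
      fun v => hf _ _, fun v hv hv' => ?_⟩
    exact (F'.mem_children.1 (f ⟨F.par v, hv⟩ ⟨v, _⟩).2).2
  · have : IsEmpty {v // F.dep v = k + 1} := ⟨fun v => by have := hF v; have := v.2; omega⟩
    have : IsEmpty {v // F'.dep v = k + 1} := ⟨fun v => by have := hF' v; have := v.2; omega⟩
    exact ⟨Equiv.equivOfIsEmpty _ _, fun v => isEmptyElim v, fun v _ hv' => isEmptyElim
      (⟨v, hv'⟩ : {v // F.dep v = k + 1})⟩

/-- Forests with the same codes are isomorphic. -/
theorem exists_equiv_of_rootCodes_eq {m : ℕ} (hF : ∀ v, F.dep v ≤ m) (hF' : ∀ v, F'.dep v ≤ m)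
    (h : F.rootCodes m = F'.rootCodes m) :
    ∃ e : V ≃ V', (∀ v, F'.dep (e v) = F.dep v) ∧
      ∀ v, F.dep v ≠ 0 → F'.par (e v) = e (F.par v) := by
  classical
  have h0 : ∃ e : {v // F.dep v = 0} ≃ {v // F'.dep v = 0},
      ∀ v, F'.code (m - 0) (e v) = F.code (m - 0) v := by
    have : ∃ e : {w // w ∈ F.level 0} ≃ {w // w ∈ F'.level 0},
        ∀ v, F'.code m (e v) = F.code m v := by
      apply exists_equiv_of_map_eq (fun w : {w // w ∈ F.level 0} => F.code m w)
        (fun w : {w // w ∈ F'.level 0} => F'.code m w)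
      have a1 := Multiset.attach_map_val' (F.level 0).val (F.code m)
      have a2 := Multiset.attach_map_val' (F'.level 0).val (F'.code m)
      rw [Finset.univ_eq_attach, Finset.univ_eq_attach, Finset.attach_val, Finset.attach_val]
      exact a1.trans (h.trans a2.symm)
    obtain ⟨e, he⟩ := this
    exact ⟨(Equiv.subtypeEquivRight fun _ => F.mem_level.symm).trans
      (e.trans (Equiv.subtypeEquivRight fun _ => F'.mem_level)), fun v => he ⟨v, _⟩⟩
  obtain ⟨e0, he0⟩ := h0
  choose g hg1 hg2 using exists_next_level hF hF'
  let E : ∀ k, {e : {v // F.dep v = k} ≃ {v // F'.dep v = k} //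
      ∀ v, F'.code (m - k) (e v) = F.code (m - k) v} :=
    fun k => Nat.rec ⟨e0, he0⟩ (fun k e => ⟨g k e.1 e.2, hg1 k e.1 e.2⟩) k
  have hE : ∀ k v (hv : F.dep (F.par v) = k) (hv' : F.dep v = k + 1),
      F'.par ((E (k + 1)).1 ⟨v, hv'⟩) = (E k).1 ⟨F.par v, hv⟩ :=
    fun k => hg2 k (E k).1 (E k).2
  let e : V ≃ V' := Equiv.ofFiberEquiv (f := F.dep) (g := F'.dep) fun k => (E k).1
  have he : ∀ k v (hv : F.dep v = k), e v = (E k).1 ⟨v, hv⟩ := by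
    rintro k v rfl
    rfl
  refine ⟨e, fun v => Equiv.ofFiberEquiv_map _ v, fun v hv => ?_⟩
  have h1 := F.dep_par v hv
  rw [he _ v h1.symm, he _ _ rfl]
  exact hE _ v rfl h1.symm

end Iso

section Realization

variable {V W : Type} [Fintype V] [Fintype W]

theorem code_map {F : Forest V} {F' : Forest W} (f : V ↪ W)
    (hf : ∀ v, F'.children (f v) = (F.children v).map f) (h : ℕ) (v : V) :
    F'.code h (f v) = F.code h v := by
  induction h generalizing v with
  | zero => rfl
  | succ h ih =>
    rw [code_succ, code_succ, hf, Finset.map_val, Multiset.map_map]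
    simp only [Function.comp_def, ih]

/-- The disjoint union of two forests. -/
def sum (F : Forest V) (F' : Forest W) : Forest (V ⊕ W) where
  par := Sum.map F.par F'.par
  dep := Sum.elim F.dep F'.dep
  dep_par := by
    rintro (v | v) h
    · exact F.dep_par v h
    · exact F'.dep_par v h

theorem rootCodes_sum (F : Forest V) (F' : Forest W) (m : ℕ) :
    (F.sum F').rootCodes m = F.rootCodes m + F'.rootCodes m := by
  classical
  have h1 : ∀ v, (F.sum F').code m (Sum.inl v) = F.code m v := by
    refine code_map Function.Embedding.inl (fun v => ?_) m
    ext (w | w) <;> simp [sum]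
  have h2 : ∀ v, (F.sum F').code m (Sum.inr v) = F'.code m v := by
    refine code_map Function.Embedding.inr (fun v => ?_) m
    ext (w | w) <;> simp [sum]
  have h3 : (F.sum F').level 0 = (F.level 0).disjSum (F'.level 0) := by
    ext (w | w) <;> simp [sum]
  rw [rootCodes, h3, Finset.val_disjSum, Multiset.disjSum, Multiset.map_add, Multiset.map_map,
    Multiset.map_map]
  simp only [Function.comp_def, h1, h2]
  rfl

/-- The tree obtained from a forest by joining its roots to a new root. -/
def addRoot (F : Forest V) : Forest (Option V) where
  par v := v.elim none fun v => if F.dep v = 0 then none else some (F.par v)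
  dep v := v.elim 0 fun v => F.dep v + 1
  dep_par := by
    rintro (_ | v) h
    · exact absurd rfl h
    · by_cases hv : F.dep v = 0
      · simp [hv]
      · simpa [hv] using F.dep_par v hv

theorem rootCodes_addRoot (F : Forest V) (m : ℕ) :
    F.addRoot.rootCodes (m + 1) = {RTree.node (F.rootCodes m)} := by
  classical
  have h1 : ∀ v, F.addRoot.code m (some v) = F.code m v := by
    refine code_map Function.Embedding.some (fun v => ?_) m
    ext (_ | w)
    · simp [addRoot]
    · by_cases hw : F.dep w = 0 <;> simp [addRoot, hw]
  have h2 : F.addRoot.level 0 = {none} := by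
    ext (_ | w) <;> simp [addRoot]
  have h3 : F.addRoot.children none = (F.level 0).map Function.Embedding.some := by
    ext (_ | w)
    · simp [addRoot]
    · by_cases hw : F.dep w = 0 <;> simp [addRoot, hw]
  rw [rootCodes, h2, Finset.singleton_val, Multiset.map_singleton, code_succ, h3, Finset.map_val,
    Multiset.map_map]
  simp only [Function.comp_def, Function.Embedding.some_apply, h1]
  rfl

/-- The tree with one node. -/
def single : Forest Unit where
  par v := v
  dep _ := 0
  dep_par _ h := absurd rfl h

/-- The forest without nodes. -/
def empty : Forest Empty where
  par v := v
  dep _ := 0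
  dep_par _ h := absurd rfl h

theorem exists_rootCodes_eq_of_forall {m : ℕ}
    (hs : ∀ x : RTree m, ∃ (V : Type) (_ : Fintype V) (F : Forest V),
      (∀ v, F.dep v ≤ m) ∧ F.rootCodes m = {x} ∧ Fintype.card V = x.size)
    (z : Multiset (RTree m)) :
    ∃ (V : Type) (_ : Fintype V) (F : Forest V),
      (∀ v, F.dep v ≤ m) ∧ F.rootCodes m = z ∧ Fintype.card V = (z.map RTree.size).sum := by
  induction z using Multiset.induction_on with
  | empty => exact ⟨Empty, inferInstance, empty, fun v => v.elim, rfl, rfl⟩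
  | cons x z ih =>
    obtain ⟨V, _, F, h1, h2, h3⟩ := ih
    obtain ⟨W, _, F', h1', h2', h3'⟩ := hs x
    refine ⟨W ⊕ V, inferInstance, F'.sum F, ?_, ?_, ?_⟩
    · rintro (v | v)
      · exact h1' v
      · exact h1 v
    · rw [rootCodes_sum, h2, h2', Multiset.singleton_add]
    · rw [Fintype.card_sum, h3, h3', Multiset.map_cons, Multiset.sum_cons]

/-- Every multiset of rooted trees is realized by a forest. -/
theorem exists_rootCodes_eq (m : ℕ) (z : Multiset (RTree m)) :
    ∃ (V : Type) (_ : Fintype V) (F : Forest V),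
      (∀ v, F.dep v ≤ m) ∧ F.rootCodes m = z ∧ Fintype.card V = (z.map RTree.size).sum := by
  induction m with
  | zero =>
    refine exists_rootCodes_eq_of_forall (fun x => ⟨Unit, inferInstance, single, fun _ => le_rfl, ?_,
      rfl⟩) z
    have : single.level 0 = {()} := by ext; simp [single]
    rw [rootCodes, this]
    rfl
  | succ m ih =>
    refine exists_rootCodes_eq_of_forall (fun x => ?_) z
    obtain ⟨V, _, F, h1, h2, h3⟩ := ih x.branches
    refine ⟨Option V, inferInstance, F.addRoot, ?_, ?_, ?_⟩
    · rintro (_ | v)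
      · exact Nat.zero_le _
      · exact Nat.succ_le_succ (h1 v)
    · rw [rootCodes_addRoot, h2, RTree.node_branches]
    · rw [Fintype.card_option, h3, add_comm]
      rfl

end Realization
end Forest
end AlkaneCount

namespace AlkaneCount
namespace Forest

open SimpleGraph

section Graph

variable {V : Type} (F : Forest V)

/-- The graph of a forest, with all roots joined to each other. -/
def graph : SimpleGraph V where
  Adj v w := v ≠ w ∧ ((F.dep v = 0 ∧ F.dep w = 0) ∨ (F.dep w ≠ 0 ∧ F.par w = v) ∨
    (F.dep v ≠ 0 ∧ F.par v = w))
  symm := ⟨fun v w h => ⟨h.1.symm, by tauto⟩⟩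
  loopless := ⟨fun v h => h.1 rfl⟩

theorem graph_adj {v w : V} : F.graph.Adj v w ↔ v ≠ w ∧ ((F.dep v = 0 ∧ F.dep w = 0) ∨
    (F.dep w ≠ 0 ∧ F.par w = v) ∨ (F.dep v ≠ 0 ∧ F.par v = w)) := Iff.rfl

theorem par_ne {v : V} (h : F.dep v ≠ 0) : F.par v ≠ v := fun e => by
  have := F.dep_par v h
  rw [e] at this
  omega

theorem adj_par {v : V} (h : F.dep v ≠ 0) : F.graph.Adj v (F.par v) :=
  ⟨(F.par_ne h).symm, Or.inr (Or.inr ⟨h, rfl⟩)⟩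

/-- The ancestor of `v` at depth `k`. -/
def anc (k : ℕ) (v : V) : V := F.par^[F.dep v - k] v

theorem anc_of_dep_le {k : ℕ} {v : V} (h : F.dep v ≤ k) : F.anc k v = v := by
  rw [anc, Nat.sub_eq_zero_of_le h]
  rfl

theorem anc_par {k : ℕ} {v : V} (h : k < F.dep v) : F.anc k (F.par v) = F.anc k v := by
  have h1 := F.dep_par v (by omega)
  rw [anc, anc, show F.dep v - k = (F.dep (F.par v) - k) + 1 by omega, Function.iterate_succ_apply]

theorem exists_walk_anc {k : ℕ} {v : V} (h : k ≤ F.dep v) :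
    F.dep (F.anc k v) = k ∧ ∃ p : F.graph.Walk v (F.anc k v), p.length + k = F.dep v := by
  obtain ⟨n, hn⟩ := Nat.exists_eq_add_of_le h
  induction n generalizing v with
  | zero =>
    rw [F.anc_of_dep_le (by omega)]
    exact ⟨by omega, Walk.nil, by simp [hn]⟩
  | succ n ih =>
    have h1 := F.dep_par v (by omega)
    have h2 := (ih (v := F.par v) (by omega) (by omega)).1
    rw [F.anc_par (by omega)] at h2
    refine ⟨h2, ?_⟩
    obtain ⟨q, hq⟩ : ∃ q : F.graph.Walk (F.par v) (F.anc k v), q.length + k = F.dep (F.par v) := by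
      rw [← F.anc_par (show k < F.dep v by omega)]
      obtain ⟨-, p, hp⟩ := ih (v := F.par v) (by omega) (by omega)
      exact ⟨p, hp⟩
    exact ⟨Walk.cons (F.adj_par (by omega)) q, by rw [Walk.length_cons]; omega⟩

theorem le_add_length_of_lipschitz {G : SimpleGraph V} (φ : V → ℤ)
    (h : ∀ v w, G.Adj v w → φ w ≤ φ v + 1) {u v : V} (p : G.Walk u v) :
    φ v ≤ φ u + p.length := by
  induction p with
  | nil => simp
  | cons hadj p ih =>
    have := h _ _ hadj
    rw [Walk.length_cons]
    push_cast
    omega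

theorem dep_le_of_adj {v w : V} (h : F.graph.Adj v w) : F.dep w ≤ F.dep v + 1 := by
  obtain ⟨-, h | h | h⟩ := F.graph_adj.1 h
  · omega
  · have := F.dep_par w h.1
    rw [h.2] at this
    omega
  · have := F.dep_par v h.1
    rw [h.2] at this
    omega

theorem dep_le_add_length {u v : V} (p : F.graph.Walk u v) : F.dep v ≤ F.dep u + p.length := by
  have := le_add_length_of_lipschitz (fun v => (F.dep v : ℤ)) (fun v w h => by
    have := F.dep_le_of_adj h
    omega) p
  omega

theorem dist_le_of_anc_eq {k : ℕ} {u v : V} (hu : k ≤ F.dep u) (hv : k ≤ F.dep v)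
    (h : F.anc k u = F.anc k v) : F.graph.dist u v + 2 * k ≤ F.dep u + F.dep v := by
  obtain ⟨-, p, hp⟩ := F.exists_walk_anc hu
  obtain ⟨-, q, hq⟩ := F.exists_walk_anc hv
  have := dist_le (p.append ((q.reverse).copy h.symm rfl))
  rw [Walk.length_append, Walk.length_copy, Walk.length_reverse] at this
  omega

theorem length_eq_dist_of_isPath {G : SimpleGraph V} (hG : G.IsTree) {u v : V} {p : G.Walk u v}
    (hp : p.IsPath) : p.length = G.dist u v := by
  obtain ⟨q, hq, hq'⟩ := hG.connected.exists_path_of_dist u v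
  rw [(hG.existsUnique_path u v).unique hp hq, hq']

/-- The graph determines a forest with given roots. -/
theorem ext_of_graph_eq {F F' : Forest V} (hg : F.graph = F'.graph)
    (h0 : ∀ v, F.dep v = 0 ↔ F'.dep v = 0) :
    (∀ v, F.dep v = F'.dep v) ∧ ∀ v, F.dep v ≠ 0 → F.par v = F'.par v := by
  have key : ∀ F F' : Forest V, F.graph = F'.graph → (∀ v, F.dep v = 0 ↔ F'.dep v = 0) →
      ∀ v, F.dep v ≤ F'.dep v := by
    intro F F' hg h0 v
    obtain ⟨h1, p, hp⟩ := F'.exists_walk_anc (Nat.zero_le (F'.dep v))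
    rw [← h0] at h1
    have := F.dep_le_add_length ((p.reverse).mapLe hg.ge)
    simp at this
    omega
  have hd : ∀ v, F.dep v = F'.dep v := fun v =>
    le_antisymm (key F F' hg h0 v) (key F' F hg.symm (fun v => (h0 v).symm) v)
  refine ⟨hd, fun v hv => ?_⟩
  have h1 := F.adj_par hv
  rw [hg] at h1
  have h2 := F.dep_par v hv
  obtain ⟨-, h | h | h⟩ := F'.graph_adj.1 h1
  · rw [hd] at hv
    exact absurd h.1 hv
  · have := F'.dep_par _ h.1
    rw [h.2, ← hd, ← hd] at this
    omega
  · exact h.2.symm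

section

variable [Fintype V] {F} {δ : ℕ}

theorem dist_root_le (hδ : δ ≤ 1) (hr : (F.level 0).card = δ + 1) {u v : V} (hu : F.dep u = 0)
    (hv : F.dep v = 0) : F.graph.dist u v ≤ δ := by
  by_cases huv : u = v
  · simp [huv]
  · have : δ ≠ 0 := by
      rintro rfl
      exact huv (Finset.card_le_one.1 hr.le u (F.mem_level.2 hu) v (F.mem_level.2 hv))
    have h1 : F.graph.Adj u v := ⟨huv, Or.inl ⟨hu, hv⟩⟩
    rw [dist_eq_one_iff_adj.2 h1]
    omega

theorem graph_connected (hr : (F.level 0).card = δ + 1) : F.graph.Connected := by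
  obtain ⟨r, hr⟩ := Finset.card_pos.1 (show 0 < (F.level 0).card by omega)
  rw [mem_level] at hr
  have : Nonempty V := ⟨r⟩
  have key : ∀ v, F.graph.Reachable v r := by
    intro v
    obtain ⟨h1, p, -⟩ := F.exists_walk_anc (Nat.zero_le (F.dep v))
    refine p.reachable.trans ?_
    by_cases h : F.anc 0 v = r
    · rw [h]
    · exact Adj.reachable ⟨h, Or.inl ⟨h1, hr⟩⟩
  exact ⟨fun u v => (key u).trans (key v).symm⟩

theorem dist_le_dep_add (hδ : δ ≤ 1) (hr : (F.level 0).card = δ + 1) (u v : V) :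
    F.graph.dist u v ≤ F.dep u + F.dep v + δ := by
  have hc := graph_connected hr
  obtain ⟨h1, p, hp⟩ := F.exists_walk_anc (Nat.zero_le (F.dep u))
  obtain ⟨h2, q, hq⟩ := F.exists_walk_anc (Nat.zero_le (F.dep v))
  have h3 := dist_root_le hδ hr h1 h2
  have h4 := dist_le p
  have h5 := dist_le q
  have h6 := hc.dist_triangle (u := u) (v := F.anc 0 u) (w := v)
  have h7 := hc.dist_triangle (u := F.anc 0 u) (v := F.anc 0 v) (w := v)
  rw [dist_comm] at h5
  omega

theorem graph_isTree (hδ : δ ≤ 1) (hr : (F.level 0).card = δ + 1) : F.graph.IsTree := by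
  classical
  have hc := graph_connected hr
  rw [isTree_iff_connected_and_card]
  refine ⟨hc, le_antisymm ?_ hc.card_vert_le_card_edgeSet_add_one⟩
  obtain ⟨a, ha⟩ := Finset.card_pos.1 (show 0 < (F.level 0).card by omega)
  rw [mem_level] at ha
  let f : {v // v ≠ a} → F.graph.edgeSet := fun v =>
    if h : F.dep v = 0 then ⟨s(v.1, a), v.2, Or.inl ⟨h, ha⟩⟩ else ⟨s(v.1, F.par v), F.adj_par h⟩
  have hf : Function.Surjective f := by
    rintro ⟨e, he⟩
    induction e using Sym2.ind with | _ v w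
    obtain ⟨hne, h | h | h⟩ := F.graph_adj.1 he
    · by_cases hv : v = a
      · subst hv
        exact ⟨⟨w, hne.symm⟩, by simp [f, h.2, Sym2.eq_swap]⟩
      · refine ⟨⟨v, hv⟩, ?_⟩
        have : w = a := by
          by_contra hw
          have := Finset.two_lt_card.2 ⟨v, F.mem_level.2 h.1, w, F.mem_level.2 h.2, a,
            F.mem_level.2 ha, hne, hv, hw⟩
          omega
        simp [f, h.1, this]
    · exact ⟨⟨w, by rintro rfl; exact h.1 ha⟩, by simp [f, h.1, h.2, Sym2.eq_swap]⟩
    · exact ⟨⟨v, by rintro rfl; exact h.1 ha⟩, by simp [f, h.1, h.2]⟩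
  have h1 := Nat.card_le_card_of_surjective f hf
  have h2 : Nat.card {v // v ≠ a} + 1 = Nat.card V := by
    rw [Nat.card_eq_fintype_card, Nat.card_eq_fintype_card, Fintype.card_subtype_compl,
      Fintype.card_subtype_eq]
    have : 0 < Fintype.card V := Fintype.card_pos_iff.2 ⟨a⟩
    omega
  omega

theorem dep_add_dep_add_le_length (hδ : δ ≤ 1) (hr : (F.level 0).card = δ + 1) {u v : V}
    (hu : 1 - δ ≤ F.dep u) (h : F.anc (1 - δ) u ≠ F.anc (1 - δ) v)
    (p : F.graph.Walk u v) : F.dep u + F.dep v + δ ≤ p.length := by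
  classical
  let φ : V → ℤ := fun w => if 1 - δ ≤ F.dep w ∧ F.anc (1 - δ) w = F.anc (1 - δ) u then
    -(F.dep w : ℤ) else F.dep w + δ
  have hpar : ∀ w, F.dep w ≠ 0 → φ w ≤ φ (F.par w) + 1 ∧ φ (F.par w) ≤ φ w + 1 := by
    intro w hw
    have h1 := F.dep_par w hw
    by_cases h2 : 1 - δ < F.dep w
    · have h3 : 1 - δ ≤ F.dep w := h2.le
      have h4 : 1 - δ ≤ F.dep (F.par w) := by omega
      simp only [φ, F.anc_par h2, h3, h4, true_and]
      split_ifs <;> omega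
    · simp only [φ]
      split_ifs <;> omega
  have hφ : ∀ a b, F.graph.Adj a b → φ b ≤ φ a + 1 := by
    rintro a b ⟨hne, h' | h' | h'⟩
    · have : δ ≠ 0 := fun h0 => hne (Finset.card_le_one.1 (by omega) a (F.mem_level.2 h'.1) b
        (F.mem_level.2 h'.2))
      simp only [φ]
      split_ifs <;> omega
    · rw [← h'.2]
      exact (hpar b h'.1).1
    · rw [← h'.2]
      exact (hpar a h'.1).2
  have h1 := le_add_length_of_lipschitz φ hφ p
  have h2 : φ u = -(F.dep u : ℤ) := if_pos ⟨hu, rfl⟩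
  have h3 : φ v = F.dep v + δ := if_neg fun e => h e.2.symm
  omega

variable (F) in
/-- A forest with `δ + 1` roots whose graph has diameter `2 * m + δ` and the roots in the
middle. -/
structure IsCentral (δ m : ℕ) : Prop where
  card_roots : (F.level 0).card = δ + 1
  dep_le : ∀ v, F.dep v ≤ m
  wide : m + δ = 0 ∨ ∃ u v, F.dep u = m ∧ F.dep v = m ∧ F.anc (1 - δ) u ≠ F.anc (1 - δ) v

theorem ediam_ne_top (hr : (F.level 0).card = δ + 1) : F.graph.ediam ≠ ⊤ := by
  obtain ⟨a, -⟩ := Finset.card_pos.1 (show 0 < (F.level 0).card by omega)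
  have : Nonempty V := ⟨a⟩
  exact connected_iff_ediam_ne_top.1 (graph_connected hr)

theorem IsCentral.diam_eq {m : ℕ} (h : F.IsCentral δ m) (hδ : δ ≤ 1) :
    F.graph.diam = 2 * m + δ := by
  obtain ⟨hr, hd, hw⟩ := h
  have hc := graph_connected hr
  obtain ⟨a, -⟩ := Finset.card_pos.1 (show 0 < (F.level 0).card by omega)
  have : Nonempty V := ⟨a⟩
  apply le_antisymm
  · obtain ⟨u, v, huv⟩ := F.graph.exists_dist_eq_diam
    rw [← huv]
    have := dist_le_dep_add hδ hr u v
    have := hd u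
    have := hd v
    omega
  · obtain hw | ⟨u, v, hu, hv, huv⟩ := hw
    · omega
    · by_cases hm : m + δ = 0
      · omega
      · obtain ⟨p, hp⟩ := hc.exists_walk_length_eq_dist u v
        have h1 := dep_add_dep_add_le_length hδ hr (by omega) huv p
        have h2 := dist_le_diam (ediam_ne_top hr) (u := u) (v := v)
        omega

/-- The roots are the middle nodes of every longest path. -/
theorem IsCentral.dep_eq_zero_iff {m : ℕ} (h : F.IsCentral δ m) (hδ : δ ≤ 1) {u v : V}
    {p : F.graph.Walk u v} (hp : p.IsPath) (hl : p.length = 2 * m + δ) (x : V) :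
    F.dep x = 0 ↔ x = p.getVert m ∨ x = p.getVert (m + δ) := by
  obtain ⟨hr, hd, hw⟩ := h
  have hc := graph_connected hr
  have hT := graph_isTree hδ hr
  have hdist := length_eq_dist_of_isPath hT hp
  have h0 := dist_le_dep_add hδ hr u v
  have hu := hd u
  have hv := hd v
  obtain ⟨h1, p1, hp1⟩ := F.exists_walk_anc (Nat.zero_le (F.dep u))
  obtain ⟨h2, p2, hp2⟩ := F.exists_walk_anc (Nat.zero_le (F.dep v))
  obtain ⟨q, hq⟩ := hc.exists_walk_length_eq_dist (F.anc 0 u) (F.anc 0 v)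
  have h3 := dist_root_le hδ hr h1 h2
  have h4 := dist_le (p1.append (q.append p2.reverse))
  have h5 : (p1.append (q.append p2.reverse)).length = p1.length + (q.length + p2.length) := by
    simp [Walk.length_append]
  have h6 : (p1.append (q.append p2.reverse)).IsPath :=
    Walk.isPath_of_length_eq_dist _ (by omega)
  have h7 := (hT.existsUnique_path u v).unique hp h6
  have h8 : p.getVert m = F.anc 0 u := by
    rw [h7, Walk.getVert_append, if_neg (by omega), show m - p1.length = 0 by omega,
      Walk.getVert_zero]
  have h9 : p.getVert (m + δ) = F.anc 0 v := by
    rw [h7, Walk.getVert_append, if_neg (by omega), Walk.getVert_append, if_neg (by omega),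
      show m + δ - p1.length - q.length = 0 by omega, Walk.getVert_zero]
  rw [h8, h9]
  refine ⟨fun hx => ?_, ?_⟩
  · by_contra! hne
    have hδ' : δ ≠ 0 := by
      rintro rfl
      exact hne.1 (Finset.card_le_one.1 hr.le x (F.mem_level.2 hx) _ (F.mem_level.2 h1))
    have h10 : F.anc 0 u ≠ F.anc 0 v := by
      intro e
      have := hc.dist_eq_zero_iff.2 e
      omega
    have := Finset.two_lt_card.2 ⟨x, F.mem_level.2 hx, _, F.mem_level.2 h1, _,
            F.mem_level.2 h2, hne.1, hne.2, h10⟩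
    omega
  · rintro (rfl | rfl) <;> assumption

end

theorem eq_of_adj_of_dist_eq {G : SimpleGraph V} (hG : G.IsTree) {a v w w' : V}
    (hw : G.Adj v w) (hw' : G.Adj v w') (h : G.dist a w + 1 = G.dist a v)
    (h' : G.dist a w' + 1 = G.dist a v) : w = w' := by
  obtain ⟨p, hp⟩ := hG.connected.exists_walk_length_eq_dist w a
  obtain ⟨q, hq⟩ := hG.connected.exists_walk_length_eq_dist w' a
  rw [dist_comm] at hp hq
  have h1 := Walk.isPath_of_length_eq_dist (Walk.cons hw p) (by
    rw [Walk.length_cons, dist_comm, hp, h])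
  have h2 := Walk.isPath_of_length_eq_dist (Walk.cons hw' q) (by
    rw [Walk.length_cons, dist_comm, hq, h'])
  have h3 := congrArg (fun p => Walk.getVert p 1) ((hG.existsUnique_path v a).unique h1 h2)
  simpa using h3

/-- A tree with one or two adjacent distinguished nodes is the graph of a forest with these
roots. -/
theorem exists_graph_eq {G : SimpleGraph V} (hG : G.IsTree) {a b : V} (hab : a = b ∨ G.Adj a b) :
    ∃ F : Forest V, F.graph = G ∧ ∀ v, F.dep v = min (G.dist a v) (G.dist b v) := by
  classical
  have hc := hG.connected
  have par : ∀ x y z, G.Adj y z → G.dist x z = G.dist x y + 1 ∨ G.dist x y = G.dist x z + 1 := by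
    intro x y z h
    have := hG.dist_eq_dist_add_one_of_adj x h
    omega
  have hab' : ∀ v, a = b ∨ G.dist a v = G.dist b v + 1 ∨ G.dist b v = G.dist a v + 1 := by
    intro v
    refine hab.imp_right fun h => ?_
    have := par v a b h
    rw [dist_comm, dist_comm (u := b)]
    omega
  have closer : ∀ x v, G.dist x v ≠ 0 → ∃ w, G.Adj v w ∧ G.dist x w + 1 = G.dist x v := by
    intro x v h
    obtain ⟨p, hp⟩ := hc.exists_walk_length_eq_dist v x
    rw [dist_comm] at hp
    cases p with
    | nil => exact absurd hp.symm h
    | cons hadj p =>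
      refine ⟨_, hadj, ?_⟩
      have h1 := dist_le p
      rw [dist_comm] at h1
      rw [Walk.length_cons] at hp
      have := par x _ _ hadj
      omega
  have ex : ∀ v, ∃ w, min (G.dist a v) (G.dist b v) ≠ 0 →
      G.Adj v w ∧ min (G.dist a w) (G.dist b w) + 1 = min (G.dist a v) (G.dist b v) := by
    intro v
    by_cases h : min (G.dist a v) (G.dist b v) = 0
    · exact ⟨v, fun h' => absurd h h'⟩
    · obtain h1 | h1 := le_total (G.dist a v) (G.dist b v)
      · obtain ⟨w, hw, hw'⟩ := closer a v (by omega)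
        refine ⟨w, fun _ => ⟨hw, ?_⟩⟩
        have := par b v w hw
        omega
      · obtain ⟨w, hw, hw'⟩ := closer b v (by omega)
        refine ⟨w, fun _ => ⟨hw, ?_⟩⟩
        have := par a v w hw
        omega
  choose p hp using ex
  let F : Forest V := ⟨p, fun v => min (G.dist a v) (G.dist b v), fun v h => (hp v h).2⟩
  have key : ∀ v w, G.Adj v w → min (G.dist a w) (G.dist b w) + 1 = min (G.dist a v) (G.dist b v) →
      p v = w := by
    intro v w hvw h
    obtain ⟨h1, h2⟩ := hp v (by omega)
    have a1 := par a v w hvw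
    have a2 := par a v _ h1
    have b1 := par b v w hvw
    have b2 := par b v _ h1
    have c := hab' v
    have c1 := hab' w
    have c2 := hab' (p v)
    by_cases h3 : G.dist a w + 1 = G.dist a v ∧ G.dist a (p v) + 1 = G.dist a v
    · exact eq_of_adj_of_dist_eq hG h1 hvw h3.2 h3.1
    · refine eq_of_adj_of_dist_eq (a := b) hG h1 hvw ?_ ?_
      · obtain rfl | c := c <;> omega
      · obtain rfl | c := c <;> omega
  have flat : ∀ v w, G.Adj v w → min (G.dist a w) (G.dist b w) = min (G.dist a v) (G.dist b v) →
      G.dist a v < G.dist b v → v = a ∧ w = b := by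
    intro v w hvw h hlt
    have hne : a ≠ b := by
      rintro rfl
      exact lt_irrefl _ hlt
    have a1 := par a v w hvw
    have b1 := par b v w hvw
    have c := (hab' v).resolve_left hne
    have c1 := (hab' w).resolve_left hne
    have hav : G.dist a v = 0 := by
      by_contra h0
      obtain ⟨x, hx, hx'⟩ := closer a v h0
      have b2 := par b v x hx
      have c2 := (hab' x).resolve_left hne
      have hwx : w = x := eq_of_adj_of_dist_eq (a := b) hG hvw hx (by omega) (by omega)
      subst hwx
      omega
    have hbw : G.dist b w = 0 := by omega
    exact ⟨(hc.dist_eq_zero_iff.1 hav).symm, (hc.dist_eq_zero_iff.1 hbw).symm⟩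
  have hroot : ∀ v, min (G.dist a v) (G.dist b v) = 0 ↔ v = a ∨ v = b := by
    intro v
    rw [← Nat.le_zero, min_le_iff, Nat.le_zero, Nat.le_zero, hc.dist_eq_zero_iff,
      hc.dist_eq_zero_iff, eq_comm, eq_comm (a := b)]
  refine ⟨F, ?_, fun v => rfl⟩
  ext v w
  rw [graph_adj]
  change v ≠ w ∧ ((min (G.dist a v) (G.dist b v) = 0 ∧ min (G.dist a w) (G.dist b w) = 0) ∨
    (min (G.dist a w) (G.dist b w) ≠ 0 ∧ p w = v) ∨
    (min (G.dist a v) (G.dist b v) ≠ 0 ∧ p v = w)) ↔ _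
  constructor
  · rintro ⟨hne, h | h | h⟩
    · rw [hroot, hroot] at h
      obtain ⟨rfl | rfl, rfl | rfl⟩ := h
      · exact absurd rfl hne
      · exact hab.resolve_left hne
      · exact (hab.resolve_left hne.symm).symm
      · exact absurd rfl hne
    · rw [← h.2]
      exact (hp w h.1).1.symm
    · rw [← h.2]
      exact (hp v h.1).1
  · intro h
    refine ⟨h.ne, ?_⟩
    have a1 := par a v w h
    have b1 := par b v w h
    obtain h1 | h1 | h1 : min (G.dist a w) (G.dist b w) + 1 = min (G.dist a v) (G.dist b v) ∨
      min (G.dist a v) (G.dist b v) + 1 = min (G.dist a w) (G.dist b w) ∨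
      min (G.dist a w) (G.dist b w) = min (G.dist a v) (G.dist b v) := by omega
    · exact Or.inr (Or.inr ⟨by omega, key v w h h1⟩)
    · exact Or.inr (Or.inl ⟨by omega, key w v h.symm h1⟩)
    · left
      rw [hroot, hroot]
      obtain h2 | h2 : G.dist a v < G.dist b v ∨ G.dist a w < G.dist b w := by omega
      · obtain ⟨rfl, rfl⟩ := flat v w h h1 h2
        exact ⟨Or.inl rfl, Or.inr rfl⟩
      · obtain ⟨rfl, rfl⟩ := flat w v h.symm h1.symm h2
        exact ⟨Or.inr rfl, Or.inl rfl⟩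

theorem dist_getVert {G : SimpleGraph V} (hG : G.Connected) {u v : V} {p : G.Walk u v}
    (hp : p.length = G.dist u v) {i : ℕ} (hi : i ≤ p.length) :
    G.dist (p.getVert i) u = i ∧ G.dist (p.getVert i) v + i = p.length := by
  have h1 := dist_le (p.take i)
  have h2 := dist_le (p.drop i)
  have h3 := hG.dist_triangle (u := u) (v := p.getVert i) (w := v)
  rw [Walk.take_length] at h1
  rw [Walk.drop_length] at h2
  rw [dist_comm] at h1
  rw [dist_comm (u := u) (v := p.getVert i)] at h3
  omega

/-- Every tree is the graph of a central forest. -/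
theorem exists_isCentral [Fintype V] {G : SimpleGraph V} (hG : G.IsTree) {δ m : ℕ} (hδ : δ ≤ 1)
    (hd : G.diam = 2 * m + δ) : ∃ F : Forest V, F.graph = G ∧ F.IsCentral δ m := by
  classical
  have hc := hG.connected
  have := hc.nonempty
  have hdiam : ∀ u v, G.dist u v ≤ 2 * m + δ := fun u v =>
    hd ▸ dist_le_diam (connected_iff_ediam_ne_top.1 hc)
  obtain ⟨u, v, huv⟩ := G.exists_dist_eq_diam
  obtain ⟨p, hp, hl⟩ := hc.exists_path_of_dist u v
  obtain ⟨a1, a2⟩ := dist_getVert hc hl (i := m) (by omega)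
  obtain ⟨b1, b2⟩ := dist_getVert hc hl (i := m + δ) (by omega)
  have hab : p.getVert m = p.getVert (m + δ) ∨ G.Adj (p.getVert m) (p.getVert (m + δ)) := by
    obtain rfl | rfl : δ = 0 ∨ δ = 1 := by omega
    · exact Or.inl rfl
    · exact Or.inr (p.adj_getVert_succ (by omega))
  obtain ⟨F, rfl, hF⟩ := exists_graph_eq hG hab
  have hr : (F.level 0).card = δ + 1 := by
    have h1 : F.level 0 = {p.getVert m, p.getVert (m + δ)} := by
      ext w
      rw [mem_level, hF, ← Nat.le_zero, min_le_iff, Nat.le_zero, Nat.le_zero, hc.dist_eq_zero_iff,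
        hc.dist_eq_zero_iff, Finset.mem_insert, Finset.mem_singleton, eq_comm,
        eq_comm (a := p.getVert (m + δ))]
    rw [h1]
    obtain rfl | rfl : δ = 0 ∨ δ = 1 := by omega
    · simp
    · exact Finset.card_pair (p.adj_getVert_succ (by omega)).ne
  have hu : F.dep u = m := by rw [hF]; omega
  have hv : F.dep v = m := by rw [hF]; omega
  have hw : m + δ = 0 ∨ F.anc (1 - δ) u ≠ F.anc (1 - δ) v := by
    by_cases h0 : m + δ = 0
    · exact Or.inl h0
    · right
      intro e
      have := F.dist_le_of_anc_eq (by omega) (by omega) e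
      omega
  refine ⟨F, rfl, hr, fun w => ?_, hw.imp_right fun h => ⟨u, v, hu, hv, h⟩⟩
  by_cases h0 : m + δ = 0
  · rw [hF]
    have := hdiam (p.getVert m) w
    omega
  · by_contra! hlt
    replace hw := hw.resolve_left h0
    have hx : ∀ x, F.dep x = m → F.anc (1 - δ) x ≠ F.anc (1 - δ) w → False := by
      intro x hx h
      obtain ⟨q, hq⟩ := hc.exists_walk_length_eq_dist x w
      have h1 := dep_add_dep_add_le_length hδ hr (by omega) h q
      have h2 := hdiam x w
      omega
    by_cases h : F.anc (1 - δ) u = F.anc (1 - δ) w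
    · exact hx v hv fun e => hw (h.trans e.symm)
    · exact hx u hu h

end Graph
end Forest
end AlkaneCount

namespace AlkaneCount

namespace RTree

/-- The height is exactly `h`. -/
def IsFull : {h : ℕ} → RTree h → Prop
  | 0, _ => True
  | _ + 1, x => ∃ y ∈ x.branches, IsFull y

/-- Every node has at most `d` children. -/
def IsAry (d : ℕ) : {h : ℕ} → RTree h → Prop
  | 0, _ => True
  | _ + 1, x => x.branches.card ≤ d ∧ ∀ y ∈ x.branches, IsAry d y

theorem isFull_node {h : ℕ} {s : Multiset (RTree h)} : (node s).IsFull ↔ ∃ y ∈ s, y.IsFull :=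
  Iff.rfl

theorem isAry_node {d h : ℕ} {s : Multiset (RTree h)} :
    (node s).IsAry d ↔ s.card ≤ d ∧ ∀ y ∈ s, y.IsAry d :=
  Iff.rfl

end RTree

open Classical in
/-- The codes of the central forests with one root (`δ = 0`) or two roots (`δ = 1`) whose graph
is `(d + 1)`-valent of diameter `2 * m + δ`. -/
def centralCodes (d : ℕ) : (δ m : ℕ) → Set (Multiset (RTree m))
  | 0, 0 => {{RTree.leaf}}
  | 0, m + 1 => {z | ∃ s : Multiset (RTree m), z = {RTree.node s} ∧ s.card ≤ d + 1 ∧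
      (∀ y ∈ s, y.IsAry d) ∧ 2 ≤ (s.filter RTree.IsFull).card}
  | _ + 1, _ => {z | z.card = 2 ∧ (∀ y ∈ z, y.IsAry d) ∧ 2 ≤ (z.filter RTree.IsFull).card}

namespace Forest

open SimpleGraph

theorem anc_eq_par_anc {V : Type} (F : Forest V) {k : ℕ} {w : V} (h : k < F.dep w) :
    F.anc k w = F.par (F.anc (k + 1) w) := by
  rw [anc, anc, show F.dep w - k = (F.dep w - (k + 1)) + 1 by omega, Function.iterate_succ_apply']

variable {V W : Type} [Fintype V] [Fintype W] {F : Forest V} {F' : Forest W}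

theorem anc_succ_mem_children (F : Forest V) {v w : V} (h : F.dep v < F.dep w)
    (hw : F.anc (F.dep v) w = v) : F.anc (F.dep v + 1) w ∈ F.children v := by
  rw [mem_children, ← F.anc_eq_par_anc h, (F.exists_walk_anc (show F.dep v + 1 ≤ F.dep w from h)).1]
  exact ⟨Nat.succ_ne_zero _, hw⟩

theorem isFull_code (h : ℕ) (v : V) :
    (F.code h v).IsFull ↔ ∃ w, F.dep w = F.dep v + h ∧ F.anc (F.dep v) w = v := by
  induction h generalizing v with
  | zero => exact iff_of_true trivial ⟨v, rfl, F.anc_of_dep_le le_rfl⟩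
  | succ h ih =>
    rw [code_succ, RTree.isFull_node]
    constructor
    · rintro ⟨y, hy, hy'⟩
      obtain ⟨v', hv', rfl⟩ := Multiset.mem_map.1 hy
      obtain ⟨w, hw, hw'⟩ := (ih v').1 hy'
      have h1 := F.dep_of_mem_children hv'
      refine ⟨w, by omega, ?_⟩
      rw [F.anc_eq_par_anc (by omega), ← h1, hw']
      exact (F.mem_children.1 hv').2
    · rintro ⟨w, hw, hw'⟩
      have h1 := F.anc_succ_mem_children (by omega) hw'
      refine ⟨_, Multiset.mem_map_of_mem _ h1, (ih _).2 ⟨w, ?_, ?_⟩⟩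
      · rw [F.dep_of_mem_children h1]
        omega
      · rw [F.dep_of_mem_children h1]

theorem isAry_code {d : ℕ} (hd : ∀ v, 0 < F.dep v → (F.children v).card ≤ d) (h : ℕ) (v : V)
    (hv : (F.children v).card ≤ d) : (F.code h v).IsAry d := by
  induction h generalizing v with
  | zero => trivial
  | succ h ih =>
    rw [code_succ, RTree.isAry_node]
    refine ⟨by rwa [Multiset.card_map], fun y hy => ?_⟩
    obtain ⟨v', hv', rfl⟩ := Multiset.mem_map.1 hy
    exact ih v' (hd v' (by rw [F.dep_of_mem_children hv']; omega))

theorem card_children_le_of_isAry {d h : ℕ} {v : V} (hF : ∀ w, F.dep w ≤ F.dep v + h)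
    (hv : (F.code h v).IsAry d) {w : V} (hw : F.dep v ≤ F.dep w) (hw' : F.anc (F.dep v) w = v) :
    (F.children w).card ≤ d := by
  induction h generalizing v with
  | zero =>
    have : F.children w = ∅ := by
      refine Finset.eq_empty_of_forall_notMem fun x hx => ?_
      have := F.dep_of_mem_children hx
      have := hF x
      omega
    simp [this]
  | succ h ih =>
    rw [code_succ, RTree.isAry_node, Multiset.card_map] at hv
    obtain hlt | heq := hw.lt_or_eq
    · have h1 := F.anc_succ_mem_children hlt hw'
      have h2 := F.dep_of_mem_children h1
      refine ih (fun x => ?_) (hv.2 _ (Multiset.mem_map_of_mem _ h1)) ?_ ?_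
      · have := hF x
        omega
      · omega
      · rw [h2]
    · rw [F.anc_of_dep_le heq.ge] at hw'
      subst hw'
      exact hv.1

/-- Equivalences compatible with depths and parents preserve the codes. -/
theorem rootCodes_eq_of_equiv (e : V ≃ W) (hd : ∀ v, F'.dep (e v) = F.dep v)
    (hp : ∀ v, F.dep v ≠ 0 → F'.par (e v) = e (F.par v)) (m : ℕ) :
    F'.rootCodes m = F.rootCodes m := by
  have h1 : ∀ v, F'.code m (e v) = F.code m v := by
    refine code_map e.toEmbedding (fun v => ?_) m
    ext w
    obtain ⟨w, rfl⟩ := e.surjective w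
    rw [mem_children, hd, Finset.mem_map_equiv, e.symm_apply_apply, mem_children]
    refine and_congr_right fun h => ?_
    rw [hp w h]
    exact e.injective.eq_iff
  have h2 : F'.level 0 = (F.level 0).map e.toEmbedding := by
    ext w
    obtain ⟨w, rfl⟩ := e.surjective w
    rw [mem_level, hd, Finset.mem_map_equiv, e.symm_apply_apply, mem_level]
  rw [rootCodes, h2, Finset.map_val, Multiset.map_map]
  exact Multiset.map_congr rfl fun v _ => h1 v

/-- Equivalences compatible with depths and parents are isomorphisms of graphs. -/
def graphIso (e : V ≃ W) (hd : ∀ v, F'.dep (e v) = F.dep v)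
    (hp : ∀ v, F.dep v ≠ 0 → F'.par (e v) = e (F.par v)) : F.graph ≃g F'.graph where
  toEquiv := e
  map_rel_iff' := by
    intro v w
    rw [graph_adj, graph_adj, hd, hd, e.injective.ne_iff]
    refine and_congr_right fun _ => or_congr_right (or_congr (and_congr_right fun h => ?_)
      (and_congr_right fun h => ?_))
    · rw [hp w h, e.injective.eq_iff]
    · rw [hp v h, e.injective.eq_iff]

/-- Transport of a forest along an equivalence. -/
def comap (e : V ≃ W) (F' : Forest W) : Forest V where
  par v := e.symm (F'.par (e v))
  dep v := F'.dep (e v)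
  dep_par v h := by
    rw [e.apply_symm_apply]
    exact F'.dep_par _ h

theorem sum_size_rootCodes {m : ℕ} (hF : ∀ v, F.dep v ≤ m) :
    ((F.rootCodes m).map RTree.size).sum = Fintype.card V := by
  obtain ⟨W, _, F', h1, h2, h3⟩ := exists_rootCodes_eq m (F.rootCodes m)
  obtain ⟨e, -⟩ := exists_equiv_of_rootCodes_eq h1 hF h2
  rw [← h3, Fintype.card_congr e]

theorem exists_anc_ne_iff {m k : ℕ} (hk : k ≤ m) [DecidablePred (RTree.IsFull (h := m - k))] :
    (∃ u v, F.dep u = m ∧ F.dep v = m ∧ F.anc k u ≠ F.anc k v) ↔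
      2 ≤ (((F.level k).val.map (F.code (m - k))).filter RTree.IsFull).card := by
  classical
  have h1 : (((F.level k).val.map (F.code (m - k))).filter RTree.IsFull).card =
      ((F.level k).filter fun v => (F.code (m - k) v).IsFull).card := by
    rw [Multiset.filter_map, Multiset.card_map, Finset.card, Finset.filter_val]
    rfl
  rw [h1, ← Nat.lt_iff_add_one_le, Finset.one_lt_card]
  constructor
  · rintro ⟨u, v, hu, hv, huv⟩
    have key : ∀ w, F.dep w = m → F.anc k w ∈
        (F.level k).filter fun v => (F.code (m - k) v).IsFull := by
      intro w hw
      have h2 := (F.exists_walk_anc (hk.trans hw.ge)).1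
      rw [Finset.mem_filter, mem_level, isFull_code]
      exact ⟨h2, w, by omega, by rw [h2]⟩
    exact ⟨_, key u hu, _, key v hv, huv⟩
  · rintro ⟨a, ha, b, hb, hab⟩
    rw [Finset.mem_filter, mem_level, isFull_code] at ha hb
    obtain ⟨rfl, u, hu, hu'⟩ := ha
    obtain ⟨hb, v, hv, hv'⟩ := hb
    refine ⟨u, v, by omega, by omega, ?_⟩
    rw [hu', ← hb, hv']
    exact hab

theorem encard_neighborSet {δ : ℕ} (hr : (F.level 0).card = δ + 1) (v : V) :
    (F.graph.neighborSet v).encard =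
      ((F.children v).card + if F.dep v = 0 then δ else 1 : ℕ) := by
  classical
  have key : ∀ X : Finset V, F.graph.neighborSet v = ↑(F.children v ∪ X) →
      Disjoint (F.children v) X → (F.graph.neighborSet v).encard =
        ((F.children v).card + X.card : ℕ) := by
    intro X h1 h2
    rw [h1, Set.encard_coe_eq_coe_finsetCard, Finset.card_union_of_disjoint h2]
  split_ifs with h
  · have hv := F.mem_level.2 h
    rw [key ((F.level 0).erase v), Finset.card_erase_of_mem hv, hr, Nat.add_sub_cancel]
    · ext w
      simp only [mem_neighborSet, graph_adj, Finset.coe_union, Set.mem_union, Finset.mem_coe,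
        mem_children, Finset.mem_erase, mem_level]
      constructor
      · rintro ⟨h1, h2 | h2 | h2⟩
        · exact Or.inr ⟨h1.symm, h2.2⟩
        · exact Or.inl h2
        · exact absurd h h2.1
      · rintro (h1 | h1)
        · exact ⟨by rintro rfl; exact h1.1 h, Or.inr (Or.inl h1)⟩
        · exact ⟨h1.1.symm, Or.inl ⟨h, h1.2⟩⟩
    · rw [Finset.disjoint_left]
      intro w hw hw'
      exact (F.mem_children.1 hw).1 (F.mem_level.1 (Finset.mem_of_mem_erase hw'))
  · rw [key {F.par v}, Finset.card_singleton]
    · ext w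
      simp only [mem_neighborSet, graph_adj, Finset.coe_union, Set.mem_union, Finset.mem_coe,
        mem_children, Finset.mem_singleton]
      constructor
      · rintro ⟨h1, h2 | h2 | h2⟩
        · exact absurd h2.1 h
        · exact Or.inl h2
        · exact Or.inr h2.2.symm
      · rintro (h1 | h1)
        · refine ⟨?_, Or.inr (Or.inl h1)⟩
          rintro rfl
          exact F.par_ne h1.1 h1.2
        · exact ⟨h1 ▸ (F.par_ne h).symm, Or.inr (Or.inr ⟨h, h1.symm⟩)⟩
    · rw [Finset.disjoint_singleton_right]
      intro h1
      have h2 := F.dep_of_mem_children h1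
      have h3 := F.dep_par v h
      omega

theorem isKValent_graph_iff {δ d : ℕ} (hr : (F.level 0).card = δ + 1) :
    IsKValent (d + 1) F.graph ↔ (∀ v, F.dep v = 0 → (F.children v).card + δ ≤ d + 1) ∧
      ∀ v, 0 < F.dep v → (F.children v).card ≤ d := by
  have h1 : IsKValent (d + 1) F.graph ↔
      ∀ v, ((F.children v).card + if F.dep v = 0 then δ else 1) ≤ d + 1 := by
    refine forall_congr' fun v => ?_
    rw [encard_neighborSet hr]
    exact_mod_cast Iff.rfl
  rw [h1, ← forall_and]
  refine forall_congr' fun v => ?_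
  split_ifs with h <;> simp [h, Nat.pos_iff_ne_zero]

theorem rootCodes_mem_centralCodes_iff {d δ m : ℕ} (hδ : δ ≤ 1) (hF : ∀ v, F.dep v ≤ m) :
    F.rootCodes m ∈ centralCodes d δ m ↔ F.IsCentral δ m ∧ IsKValent (d + 1) F.graph := by
  classical
  obtain rfl | rfl : δ = 0 ∨ δ = 1 := by omega
  · cases m with
    | zero =>
      have hc : ∀ v, F.children v = ∅ := fun v => Finset.eq_empty_of_forall_notMem fun w hw =>
        (F.mem_children.1 hw).1 (Nat.le_zero.1 (hF w))
      have h1 : F.rootCodes 0 ∈ centralCodes d 0 0 ↔ (F.level 0).card = 1 := by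
        rw [← Finset.card_val, ← Multiset.card_map (F.code 0)]
        constructor
        · intro h
          exact (congrArg Multiset.card (show F.rootCodes 0 = {RTree.leaf} from h)).trans
            (Multiset.card_singleton _)
        · intro h
          obtain ⟨x, hx⟩ := Multiset.card_eq_one.1 h
          exact hx
      rw [h1]
      constructor
      · intro hr
        refine ⟨⟨hr, hF, Or.inl rfl⟩, (isKValent_graph_iff hr).2 ⟨?_, ?_⟩⟩ <;> simp [hc]
      · exact fun h => h.1.card_roots
    | succ m =>
      have hsucc : ∀ c, (∀ v, F.dep v = 0 ↔ v = c) → F.children c = F.level 1 := by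
        intro c hc
        ext w
        rw [mem_children, mem_level]
        constructor
        · rintro ⟨h1, h2⟩
          have := F.dep_par w h1
          rw [h2, (hc c).2 rfl] at this
          exact this.symm
        · intro h
          have := F.dep_par w (by omega)
          exact ⟨by omega, (hc _).1 (by omega)⟩
      have hroot : ∀ c, F.level 0 = {c} → ∀ v, F.dep v = 0 ↔ v = c := by
        intro c hc v
        rw [← mem_level, hc, Finset.mem_singleton]
      have hcode : ∀ c, F.level 0 = {c} →
          F.rootCodes (m + 1) = {RTree.node ((F.level 1).val.map (F.code m))} := by
        intro c hc
        rw [rootCodes, hc, Finset.singleton_val, Multiset.map_singleton, code_succ,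
          hsucc c (hroot c hc)]
      have hw := exists_anc_ne_iff (F := F) (show 1 ≤ m + 1 by omega)
      rw [Nat.add_sub_cancel] at hw
      constructor
      · rintro ⟨s, hs, hs1, hs2, hs3⟩
        have hr : (F.level 0).card = 0 + 1 := by
          have := congrArg Multiset.card hs
          rwa [rootCodes, Multiset.card_map, Multiset.card_singleton] at this
        obtain ⟨c, hc⟩ := Finset.card_eq_one.1 hr
        rw [hcode c hc] at hs
        have hs' : (F.level 1).val.map (F.code m) = s :=
          RTree.node_injective (Multiset.singleton_inj.1 hs)
        subst hs'
        refine ⟨⟨hr, hF, Or.inr (hw.2 hs3)⟩, (isKValent_graph_iff hr).2 ⟨fun v hv => ?_,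
          fun v hv => ?_⟩⟩
        · rw [Multiset.card_map] at hs1
          rw [(hroot c hc v).1 hv, hsucc c (hroot c hc)]
          exact hs1
        · have h1 := (F.exists_walk_anc (k := 1) hv).1
          refine card_children_le_of_isAry (v := F.anc 1 v) (h := m) (fun w => ?_) ?_ ?_ ?_
          · have := hF w
            omega
          · exact hs2 _ (Multiset.mem_map_of_mem _ (F.mem_level.2 h1))
          · omega
          · rw [h1]
      · rintro ⟨⟨hr, -, h2⟩, hk⟩
        obtain ⟨c, hc⟩ := Finset.card_eq_one.1 hr
        rw [isKValent_graph_iff hr] at hk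
        refine ⟨_, hcode c hc, ?_, ?_, hw.1 (h2.resolve_left (by omega))⟩
        · rw [Multiset.card_map, ← hsucc c (hroot c hc)]
          exact hk.1 c ((hroot c hc c).2 rfl)
        · intro y hy
          obtain ⟨v, hv, rfl⟩ := Multiset.mem_map.1 hy
          have := F.mem_level.1 hv
          exact isAry_code hk.2 m v (hk.2 v (by omega))
  · have hw := exists_anc_ne_iff (F := F) (Nat.zero_le m)
    rw [Nat.sub_zero] at hw
    change ((F.rootCodes m).card = 2 ∧ (∀ y ∈ F.rootCodes m, y.IsAry d) ∧
      2 ≤ ((F.rootCodes m).filter RTree.IsFull).card) ↔ _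
    rw [show (F.rootCodes m).card = (F.level 0).card from Multiset.card_map _ _]
    constructor
    · rintro ⟨hr, h1, h2⟩
      have key : ∀ v, (F.children v).card ≤ d := by
        intro v
        have h3 := (F.exists_walk_anc (Nat.zero_le (F.dep v))).1
        refine card_children_le_of_isAry (v := F.anc 0 v) (h := m) (fun w => ?_) ?_ ?_ ?_
        · have := hF w
          omega
        · exact h1 _ (Multiset.mem_map_of_mem _ (F.mem_level.2 h3))
        · omega
        · rw [h3]
      exact ⟨⟨hr, hF, Or.inr (hw.2 h2)⟩, (isKValent_graph_iff hr).2
        ⟨fun v _ => Nat.succ_le_succ (key v), fun v _ => key v⟩⟩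
    · rintro ⟨⟨hr, -, h2⟩, hk⟩
      rw [isKValent_graph_iff hr] at hk
      refine ⟨hr, fun y hy => ?_, hw.1 (h2.resolve_left (by omega))⟩
      obtain ⟨v, hv, rfl⟩ := Multiset.mem_map.1 hy
      exact isAry_code hk.2 m v (Nat.succ_le_succ_iff.1 (hk.1 v (F.mem_level.1 hv)))

end Forest
end AlkaneCount

namespace AlkaneCount

open SimpleGraph

theorem Forest.rootCodes_comap {V W : Type} [Fintype V] [Fintype W] (F : Forest W) (e : V ≃ W)
    (m : ℕ) : (F.comap e).rootCodes m = F.rootCodes m :=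
  (rootCodes_eq_of_equiv e (fun _ => rfl) (fun _ _ => (e.apply_symm_apply _).symm) m).symm

theorem Forest.graph_comap {V W : Type} (F : Forest W) (e : V ≃ W) :
    (F.comap e).graph = F.graph.comap e := by
  let i : (F.comap e).graph ≃g F.graph :=
    graphIso e (fun _ => rfl) (fun _ _ => (e.apply_symm_apply _).symm)
  ext v w
  exact i.map_adj_iff.symm

/-- A multiset of rooted trees of height at most `s.1`, together with the height. -/
abbrev Code : Type := Σ m : ℕ, Multiset (RTree m)

/-- The codes of the `(d + 1)`-valent central forests with `n` nodes and `δ + 1` roots. -/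
def codes (d δ n : ℕ) : Set Code :=
  {s | s.2 ∈ centralCodes d δ s.1 ∧ (s.2.map RTree.size).sum = n}

/-- The `k`-valent trees whose diameter has the form `2 * m + δ`. -/
def IsTreeOfParity (k δ : ℕ) {V : Type} (G : SimpleGraph V) : Prop :=
  G.IsTree ∧ (∃ m, G.diam = 2 * m + δ) ∧ IsKValent k G

theorem diam_eq_of_iso {V W : Type} {G : SimpleGraph V} {H : SimpleGraph W} (e : G ≃g H) :
    G.diam = H.diam := by
  have key : ∀ {V W : Type} {G : SimpleGraph V} {H : SimpleGraph W} (_ : G ≃g H),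
      H.ediam ≤ G.ediam := by
    intro V W G H e
    refine ediam_le_of_edist_le fun u v => ?_
    obtain ⟨u, rfl⟩ := e.surjective u
    obtain ⟨v, rfl⟩ := e.surjective v
    refine le_trans (le_iInf fun p => ?_) (G.edist_le_ediam (u := u) (v := v))
    exact (edist_le (p.map e.toHom)).trans (by rw [Walk.length_map])
  exact congrArg ENat.toNat (le_antisymm (key e.symm) (key e))

theorem codes_unique {V : Type} [Fintype V] {F F' : Forest V} {d δ m m' : ℕ} (hδ : δ ≤ 1)
    (hF : ∀ v, F.dep v ≤ m) (hF' : ∀ v, F'.dep v ≤ m') (h : F.rootCodes m ∈ centralCodes d δ m)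
    (h' : F'.rootCodes m' ∈ centralCodes d δ m') (hg : F.graph = F'.graph) :
    (⟨m, F.rootCodes m⟩ : Code) = ⟨m', F'.rootCodes m'⟩ := by
  have hc := ((Forest.rootCodes_mem_centralCodes_iff hδ hF).1 h).1
  have hc' := ((Forest.rootCodes_mem_centralCodes_iff hδ hF').1 h').1
  have hd := hc.diam_eq hδ
  have hd' := hc'.diam_eq hδ
  rw [← hg, hd] at hd'
  obtain rfl : m = m' := by omega
  have hcon := Forest.graph_connected hc.card_roots
  have := hcon.nonempty
  obtain ⟨u, v, huv⟩ := F.graph.exists_dist_eq_diam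
  obtain ⟨p, hp, hl⟩ := hcon.exists_path_of_dist u v
  have h0 : ∀ x, F.dep x = 0 ↔ F'.dep x = 0 := by
    intro x
    rw [hc.dep_eq_zero_iff hδ hp (by omega), hc'.dep_eq_zero_iff hδ
      (p := p.mapLe hg.le) (hp.mapLe _) (by simp; omega)]
    simp
  obtain ⟨h1, h2⟩ := Forest.ext_of_graph_eq hg h0
  rw [Forest.rootCodes_eq_of_equiv (F := F) (F' := F') (Equiv.refl V) (fun v => (h1 v).symm)
    (fun v hv => (h2 v hv).symm)]

theorem numUnlabeled_isTreeOfParity (d n : ℕ) {δ : ℕ} (hδ : δ ≤ 1) :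
    numUnlabeled n (IsTreeOfParity (d + 1) δ) = (codes d δ n).ncard := by
  classical
  have real : ∀ s : codes d δ n, ∃ F : Forest (Fin n), (∀ v, F.dep v ≤ s.1.1) ∧
      F.rootCodes s.1.1 = s.1.2 := by
    rintro ⟨⟨m, z⟩, hz, hn⟩
    obtain ⟨V, _, F, h1, h2, h3⟩ := Forest.exists_rootCodes_eq m z
    have e : Fin n ≃ V := (Fintype.equivFinOfCardEq (h3.trans hn)).symm
    exact ⟨F.comap e, fun v => h1 _, (F.rootCodes_comap e m).trans h2⟩
  choose f hf1 hf2 using real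
  have hmem : ∀ s, (f s).rootCodes s.1.1 ∈ centralCodes d δ s.1.1 := fun s => by
    rw [hf2]
    exact s.2.1
  let g : codes d δ n → UnlabeledGraph n := fun s => Quotient.mk (isoSetoid n) (f s).graph
  have hg : Function.Injective g := by
    intro s s' h
    obtain ⟨e⟩ : Nonempty ((f s).graph ≃g (f s').graph) := Quotient.exact h
    have h1 := (f s').rootCodes_comap e.toEquiv s'.1.1
    have h2 : (f s).graph = ((f s').comap e.toEquiv).graph := by
      rw [Forest.graph_comap]
      ext v w
      exact e.map_adj_iff.symm
    have h3 := codes_unique (F' := (f s').comap e.toEquiv) hδ (hf1 s) (fun v => hf1 s' _) (hmem s) (by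
      rw [h1]
      exact hmem s') h2
    rw [h1, hf2, hf2] at h3
    exact Subtype.ext h3
  have himage : {q : UnlabeledGraph n | ∃ G : SimpleGraph (Fin n), Quotient.mk (isoSetoid n) G = q ∧
      IsTreeOfParity (d + 1) δ G} = Set.range g := by
    ext q
    constructor
    · rintro ⟨G, rfl, hG, ⟨m, hm⟩, hk⟩
      obtain ⟨F, rfl, hF⟩ := Forest.exists_isCentral hG hδ hm
      have h1 := (Forest.rootCodes_mem_centralCodes_iff hδ hF.dep_le).2 ⟨hF, hk⟩
      let s : codes d δ n := ⟨⟨m, F.rootCodes m⟩, h1, by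
        rw [Forest.sum_size_rootCodes hF.dep_le, Fintype.card_fin]⟩
      obtain ⟨e, he1, he2⟩ := Forest.exists_equiv_of_rootCodes_eq (hf1 s) hF.dep_le (hf2 s)
      exact ⟨s, Quotient.sound ⟨Forest.graphIso e he1 he2⟩⟩
    · rintro ⟨s, rfl⟩
      obtain ⟨h1, h2⟩ := (Forest.rootCodes_mem_centralCodes_iff hδ (hf1 s)).1 (hmem s)
      exact ⟨_, rfl, Forest.graph_isTree hδ h1.card_roots, ⟨_, h1.diam_eq hδ⟩, h2⟩
  rw [numUnlabeled, himage, ← Set.image_univ, Set.ncard_image_of_injective _ hg, Set.ncard_univ]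
  rfl

theorem isCenteredTree_iff {n : ℕ} {G : SimpleGraph (Fin n)} :
    IsCenteredTree G ↔ G.IsTree ∧ ∃ m, G.diam = 2 * m + 0 := by
  refine and_congr_right fun hG => exists_congr fun m => and_iff_left_of_imp fun hm => ?_
  obtain ⟨F, rfl, hF⟩ := Forest.exists_isCentral hG zero_le_one hm
  have hcon := hG.connected
  have := hcon.nonempty
  obtain ⟨u, v, huv⟩ := F.graph.exists_dist_eq_diam
  obtain ⟨p, hp, hl⟩ := hcon.exists_path_of_dist u v
  refine ⟨p.getVert m, fun u' v' p' hp' hl' => ?_, fun c hc => (hc u v p hp (by omega)).symm⟩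
  have h1 := (hF.dep_eq_zero_iff zero_le_one hp' hl' _).2 (Or.inl rfl)
  rw [hF.dep_eq_zero_iff zero_le_one hp (by omega)] at h1
  simpa using h1

theorem isBicenteredTree_iff {n : ℕ} {G : SimpleGraph (Fin n)} :
    IsBicenteredTree G ↔ G.IsTree ∧ ∃ m, G.diam = 2 * m + 1 := by
  refine and_congr_right fun hG => exists_congr fun m => and_iff_left_of_imp fun hm => ?_
  obtain ⟨F, rfl, hF⟩ := Forest.exists_isCentral hG le_rfl hm
  have hcon := hG.connected
  have := hcon.nonempty
  obtain ⟨u, v, huv⟩ := F.graph.exists_dist_eq_diam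
  obtain ⟨p, hp, hl⟩ := hcon.exists_path_of_dist u v
  refine ⟨s(p.getVert m, p.getVert (m + 1)), fun u' v' p' hp' hl' => ?_,
    fun c hc => (hc u v p hp (by omega)).symm⟩
  have h1 := hF.dep_eq_zero_iff le_rfl hp' hl'
  have h2 := hF.dep_eq_zero_iff le_rfl hp (by omega)
  have h3 := (p'.adj_getVert_succ (i := m) (by omega)).ne
  have h4 := (h2 _).1 ((h1 _).2 (Or.inl rfl))
  have h5 := (h2 _).1 ((h1 _).2 (Or.inr rfl))
  rw [Sym2.eq_iff]
  obtain h4 | h4 := h4 <;> obtain h5 | h5 := h5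
  · exact absurd (h4.trans h5.symm) h3
  · exact Or.inl ⟨h4, h5⟩
  · exact Or.inr ⟨h4, h5⟩
  · exact absurd (h4.trans h5.symm) h3

theorem numCentered_eq (d n : ℕ) : numCentered (d + 1) n = (codes d 0 n).ncard := by
  rw [← numUnlabeled_isTreeOfParity d n zero_le_one, numCentered]
  congr 1
  ext G
  rw [isCenteredTree_iff, IsTreeOfParity, and_assoc]

theorem numBicentered_eq (d n : ℕ) : numBicentered (d + 1) n = (codes d 1 n).ncard := by
  rw [← numUnlabeled_isTreeOfParity d n le_rfl, numBicentered]
  congr 1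
  ext G
  rw [isBicenteredTree_iff, IsTreeOfParity, and_assoc]

/-- Every tree is either centered or bicentered. -/
theorem numTrees_eq (k n : ℕ) : numTrees k n = numCentered k n + numBicentered k n := by
  rw [numTrees, numCentered, numBicentered, numUnlabeled, numUnlabeled, numUnlabeled,
    ← Set.ncard_union_eq]
  · congr 1
    ext q
    simp only [Set.mem_ofPred_eq, Set.mem_union, ← exists_or]
    refine exists_congr fun G => ?_
    rw [← and_or_left, isCenteredTree_iff, isBicenteredTree_iff, ← or_and_right, ← and_or_left]
    refine and_congr_right fun _ => and_congr_left fun _ => (and_iff_left ?_).symm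
    obtain ⟨m, h | h⟩ := Nat.even_or_odd' G.diam
    · exact Or.inl ⟨m, h⟩
    · exact Or.inr ⟨m, h⟩
  · rw [Set.disjoint_left]
    rintro q ⟨G, rfl, h, -⟩ ⟨H, hH, h', -⟩
    obtain ⟨e⟩ : Nonempty (H ≃g G) := Quotient.exact hH
    obtain ⟨-, m, hm⟩ := isCenteredTree_iff.1 h
    obtain ⟨-, m', hm'⟩ := isBicenteredTree_iff.1 h'
    have := diam_eq_of_iso e
    omega

end AlkaneCount

namespace AlkaneCount

section Multisets

variable {α : Type} (w : α → ℕ)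

open Classical in
/-- The multisets of total weight `n` whose elements satisfy `P` or `Q`, where the pair of the
numbers of elements with `P` and with `Q` belongs to `I`. -/
def mixed (P Q : α → Prop) (I : Finset (ℕ × ℕ)) (n : ℕ) : Set (Multiset α) :=
  {s | (∀ x ∈ s, P x ∨ Q x) ∧ ((s.filter P).card, (s.filter Q).card) ∈ I ∧ (s.map w).sum = n}

theorem mem_mixed {P Q : α → Prop} [DecidablePred P] [DecidablePred Q] {I : Finset (ℕ × ℕ)} {n : ℕ}
    {s : Multiset α} : s ∈ mixed w P Q I n ↔ (∀ x ∈ s, P x ∨ Q x) ∧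
      ((s.filter P).card, (s.filter Q).card) ∈ I ∧ (s.map w).sum = n := by
  rw [mixed, Set.mem_ofPred_eq]
  congr!

/-- The multisets of `k` elements with `P` that have total weight `n`. -/
def uniform (P : α → Prop) (k n : ℕ) : Set (Multiset α) :=
  {s | (∀ x ∈ s, P x) ∧ s.card = k ∧ (s.map w).sum = n}

theorem encard_biUnion_finset {ι β : Type*} (t : Finset ι) {s : ι → Set β}
    (hs : (t : Set ι).PairwiseDisjoint s) :
    (⋃ i ∈ t, s i).encard = ∑ i ∈ t, (s i).encard := by
  have := t.finite_toSet.encard_biUnion hs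
  rw [finsum_mem_coe_finset] at this
  exact this

theorem filter_add_filter {P Q : α → Prop} [DecidablePred P] [DecidablePred Q]
    (hPQ : ∀ x, P x → ¬ Q x) {s : Multiset α} (h : ∀ x ∈ s, P x ∨ Q x) :
    s.filter P + s.filter Q = s := by
  have h1 : s.filter Q = s.filter fun x => ¬ P x := Multiset.filter_congr fun x hx =>
    ⟨fun hq hp => hPQ x hp hq, fun hp => (h x hx).resolve_left hp⟩
  rw [h1, Multiset.filter_add_not]

theorem mixed_antidiagonal {P Q : α → Prop} (hPQ : ∀ x, P x → ¬ Q x) (k n : ℕ) :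
    mixed w P Q (Finset.HasAntidiagonal.antidiagonal k) n =
      uniform w (fun x => P x ∨ Q x) k n := by
  classical
  ext s
  refine and_congr_right fun hs => and_congr_left fun _ => ?_
  rw [Finset.HasAntidiagonal.mem_antidiagonal, ← Multiset.card_add, filter_add_filter hPQ hs]

theorem encard_mixed {P Q : α → Prop} (hPQ : ∀ x, P x → ¬ Q x) (I : Finset (ℕ × ℕ)) (n : ℕ) :
    (mixed w P Q I n).encard = ∑ k ∈ I, ∑ ab ∈ Finset.HasAntidiagonal.antidiagonal n,
      (uniform w P k.1 ab.1).encard * (uniform w Q k.2 ab.2).encard := by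
  classical
  let φ : Multiset α × Multiset α → Multiset α := fun st => st.1 + st.2
  let U : Set (Multiset α × Multiset α) := ⋃ k ∈ I, ⋃ ab ∈ Finset.HasAntidiagonal.antidiagonal n,
    uniform w P k.1 ab.1 ×ˢ uniform w Q k.2 ab.2
  have hU : ∀ st, st ∈ U ↔ (∀ x ∈ st.1, P x) ∧ (∀ x ∈ st.2, Q x) ∧
      (st.1.card, st.2.card) ∈ I ∧ (st.1.map w).sum + (st.2.map w).sum = n := by
    rintro ⟨s, t⟩
    simp only [U, Set.mem_iUnion, Set.mem_prod, uniform, Set.mem_ofPred_eq,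
      Finset.HasAntidiagonal.mem_antidiagonal, exists_prop]
    constructor
    · rintro ⟨⟨i, j⟩, hk, ⟨a, b⟩, hab, ⟨h1, rfl, rfl⟩, h2, rfl, rfl⟩
      exact ⟨h1, h2, hk, hab⟩
    · rintro ⟨h1, h2, h3, h4⟩
      exact ⟨(_, _), h3, (_, _), h4, ⟨h1, rfl, rfl⟩, h2, rfl, rfl⟩
  have hP : ∀ st ∈ U, (st.1 + st.2).filter P = st.1 := by
    intro st h
    obtain ⟨h1, h2, -⟩ := (hU st).1 h
    rw [Multiset.filter_add, Multiset.filter_eq_self.2 h1,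
      Multiset.filter_eq_nil.2 fun x hx hx' => hPQ x hx' (h2 x hx), add_zero]
  have hQ : ∀ st ∈ U, (st.1 + st.2).filter Q = st.2 := by
    intro st h
    obtain ⟨h1, h2, -⟩ := (hU st).1 h
    rw [Multiset.filter_add, Multiset.filter_eq_self.2 h2,
      Multiset.filter_eq_nil.2 fun x hx hx' => hPQ x (h1 x hx) hx', zero_add]
  have hinj : Set.InjOn φ U := by
    intro st h st' h' e
    have e' : st.1 + st.2 = st'.1 + st'.2 := e
    exact Prod.ext (by rw [← hP st h, e', hP st' h']) (by rw [← hQ st h, e', hQ st' h'])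
  have himage : mixed w P Q I n = φ '' U := by
    ext s
    constructor
    · rintro ⟨h1, h2, h3⟩
      have hs := filter_add_filter hPQ h1
      refine ⟨(s.filter P, s.filter Q), (hU _).2 ⟨fun x hx => Multiset.of_mem_filter hx,
        fun x hx => Multiset.of_mem_filter hx, h2, ?_⟩, hs⟩
      rw [← Multiset.sum_add, ← Multiset.map_add, hs, h3]
    · rintro ⟨st, h, rfl⟩
      obtain ⟨h1, h2, h3, h4⟩ := (hU st).1 h
      refine ⟨fun x hx => (Multiset.mem_add.1 hx).imp (h1 x) (h2 x), ?_, ?_⟩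
      · simp only [φ]
        rwa [hP st h, hQ st h]
      · simp only [φ]
        rw [Multiset.map_add, Multiset.sum_add, h4]
  rw [himage, hinj.encard_image, encard_biUnion_finset]
  · refine Finset.sum_congr rfl fun k _ => ?_
    rw [encard_biUnion_finset]
    · exact Finset.sum_congr rfl fun ab _ => Set.encard_prod
    · intro ab _ ab' _ hne
      refine Set.disjoint_left.2 ?_
      rintro ⟨s, t⟩ ⟨h1, h2⟩ ⟨h1', h2'⟩
      exact hne (Prod.ext (h1.2.2.symm.trans h1'.2.2) (h2.2.2.symm.trans h2'.2.2))
  · intro k _ k' _ hne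
    refine Set.disjoint_left.2 ?_
    rintro ⟨s, t⟩ h h'
    simp only [Set.mem_iUnion, Set.mem_prod, exists_prop] at h h'
    obtain ⟨ab, -, h1, h2⟩ := h
    obtain ⟨ab', -, h1', h2'⟩ := h'
    exact hne (Prod.ext (h1.2.1.symm.trans h1'.2.1) (h2.2.1.symm.trans h2'.2.1))

theorem encard_multiset_card_eq {A : Set α} {c : ℕ} (hA : A.encard = c) (k : ℕ) :
    {s : Multiset α | (∀ x ∈ s, x ∈ A) ∧ s.card = k}.encard = (c.multichoose k : ℕ) := by
  classical
  have hfin : A.Finite := Set.finite_of_encard_eq_coe hA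
  have := hfin.fintype
  have hc : Fintype.card A = c := by
    rw [Set.encard_eq_coe_toFinset_card, Set.toFinset_card] at hA
    exact_mod_cast hA
  have h1 : {s : Multiset α | (∀ x ∈ s, x ∈ A) ∧ s.card = k} =
      Set.range fun s : Sym A k => (s : Multiset A).map Subtype.val := by
    ext s
    constructor
    · rintro ⟨h1, h2⟩
      refine ⟨⟨s.attach.map fun x : {x // x ∈ s} => (⟨x.1, h1 x.1 x.2⟩ : A), by simp [h2]⟩, ?_⟩
      simp [Multiset.map_map]
    · rintro ⟨⟨s, rfl⟩, rfl⟩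
      simp +contextual
  have h2 : Function.Injective fun s : Sym A k => (s : Multiset A).map Subtype.val :=
    (Multiset.map_injective Subtype.val_injective).comp Sym.coe_injective
  rw [h1, ← Set.image_univ, h2.encard_image, Set.encard_univ, ENat.card_eq_coe_fintype_card,
    Sym.card_sym_eq_multichoose, hc]

/-- If there are `a i` objects of weight `i`, the number of multisets of `k` objects of weight at
most `j` that have total weight `n`. -/
def multisetCount (a : ℕ → ℕ) : ℕ → ℕ → ℕ → ℕ
  | 0, k, n => if k = 0 ∧ n = 0 then 1 else 0
  | j + 1, k, n => ∑ i ∈ Finset.range (k + 1), if i * (j + 1) ≤ n then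
      (a (j + 1)).multichoose i * multisetCount a j (k - i) (n - i * (j + 1)) else 0

theorem encard_uniform_weight_eq {P : α → Prop} {j c : ℕ} (hc : {x | P x ∧ w x = j}.encard = c)
    (k n : ℕ) : (uniform w (fun x => P x ∧ w x = j) k n).encard =
      if n = k * j then (c.multichoose k : ℕ∞) else 0 := by
  have key : ∀ s : Multiset α, (∀ x ∈ s, P x ∧ w x = j) → (s.map w).sum = s.card * j := by
    intro s h
    rw [Multiset.map_congr rfl fun x hx => (h x hx).2, Multiset.map_const', Multiset.sum_replicate,
      smul_eq_mul]
  split_ifs with h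
  · rw [← encard_multiset_card_eq hc k]
    congr 1
    ext s
    refine and_congr_right fun hs => and_iff_left_of_imp fun hk => ?_
    rw [key s hs, hk, h]
  · rw [Set.encard_eq_zero, Set.eq_empty_iff_forall_notMem]
    rintro s ⟨h1, h2, h3⟩
    rw [key s h1, h2] at h3
    exact h h3.symm

theorem encard_uniform_weight_le {P : α → Prop} {a : ℕ → ℕ} (hw : ∀ x, 0 < w x)
    (ha : ∀ i, {x | P x ∧ w x = i}.encard = a i) (j k n : ℕ) :
    (uniform w (fun x => P x ∧ w x ≤ j) k n).encard = multisetCount a j k n := by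
  classical
  induction j generalizing k n with
  | zero =>
    have h0 : uniform w (fun x => P x ∧ w x ≤ 0) k n = {s | s = 0 ∧ k = 0 ∧ n = 0} := by
      ext s
      constructor
      · rintro ⟨h1, rfl, rfl⟩
        have : s = 0 := Multiset.eq_zero_of_forall_notMem fun x hx =>
          (hw x).ne' (Nat.le_zero.1 (h1 x hx).2)
        simp [this]
      · rintro ⟨rfl, rfl, rfl⟩
        exact ⟨by simp, rfl, rfl⟩
    rw [h0, multisetCount]
    split_ifs with h
    · simp [h]
    · simp [h]
  | succ j ih =>
    have h1 : uniform w (fun x => P x ∧ w x ≤ j + 1) k n =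
        mixed w (fun x => P x ∧ w x = j + 1) (fun x => P x ∧ w x ≤ j)
          (Finset.HasAntidiagonal.antidiagonal k) n := by
      rw [mixed_antidiagonal w fun x h h' => by omega]
      congr 1
      funext x
      rw [← and_or_left, Nat.le_succ_iff, or_comm]
    rw [h1, encard_mixed w (fun x h h' => by omega), multisetCount,
      Finset.Nat.sum_antidiagonal_eq_sum_range_succ_mk]
    push_cast
    refine Finset.sum_congr rfl fun i _ => ?_
    simp only [encard_uniform_weight_eq w (ha (j + 1)), ih]
    split_ifs with h
    · rw [Finset.sum_eq_single (i * (j + 1), n - i * (j + 1))]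
      · simp
      · rintro ⟨b, b'⟩ hb hne
        rw [Finset.HasAntidiagonal.mem_antidiagonal] at hb
        rw [if_neg, zero_mul]
        rintro rfl
        refine hne (Prod.ext rfl ?_)
        simp only at hb ⊢
        omega
      · intro h'
        rw [Finset.HasAntidiagonal.mem_antidiagonal] at h'
        exact absurd (by simp only; omega) h'
    · refine Finset.sum_eq_zero fun b hb => ?_
      rw [Finset.HasAntidiagonal.mem_antidiagonal] at hb
      rw [if_neg (by omega), zero_mul]

theorem encard_uniform {P : α → Prop} {a : ℕ → ℕ} (hw : ∀ x, 0 < w x)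
    (ha : ∀ i, {x | P x ∧ w x = i}.encard = a i) {j k n : ℕ} (hj : n ≤ j) :
    (uniform w P k n).encard = multisetCount a j k n := by
  rw [← encard_uniform_weight_le w hw ha]
  congr 1
  ext s
  refine and_congr_left fun hs => forall₂_congr fun x hx => (and_iff_left ?_).symm
  have := Multiset.single_le_sum (fun _ _ => Nat.zero_le _) _ (Multiset.mem_map_of_mem w hx)
  omega

/-- If there are `f i` objects of weight `i` of one sort and `g i` of another, the number of
multisets of total weight `n` for which the pair of the numbers of objects of both sorts belongs
to `I`. -/
def mixedCount (f g : ℕ → ℕ) (I : Finset (ℕ × ℕ)) (n : ℕ) : ℕ :=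
  ∑ k ∈ I, ∑ ab ∈ Finset.HasAntidiagonal.antidiagonal n, multisetCount f n k.1 ab.1 * multisetCount g n k.2 ab.2

theorem encard_mixed_eq_mixedCount {P Q : α → Prop} {f g : ℕ → ℕ} (hw : ∀ x, 0 < w x)
    (hf : ∀ i, {x | P x ∧ w x = i}.encard = f i) (hg : ∀ i, {x | Q x ∧ w x = i}.encard = g i)
    (hPQ : ∀ x, P x → ¬ Q x) (I : Finset (ℕ × ℕ)) (n : ℕ) :
    (mixed w P Q I n).encard = mixedCount f g I n := by
  rw [encard_mixed w hPQ, mixedCount]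
  push_cast
  refine Finset.sum_congr rfl fun k _ => Finset.sum_congr rfl fun ab hab => ?_
  rw [Finset.HasAntidiagonal.mem_antidiagonal] at hab
  rw [encard_uniform w hw hf (j := n) (by omega), encard_uniform w hw hg (j := n) (by omega)]

end Multisets
end AlkaneCount

namespace AlkaneCount

/-- The pairs `(i, j)` with `t ≤ i` and `i + j ≤ D`. -/
def indexPairs (t D : ℕ) : Finset (ℕ × ℕ) :=
  (Finset.range (D + 1) ×ˢ Finset.range (D + 1)).filter fun k => t ≤ k.1 ∧ k.1 + k.2 ≤ D

theorem mem_indexPairs {t D : ℕ} {k : ℕ × ℕ} :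
    k ∈ indexPairs t D ↔ t ≤ k.1 ∧ k.1 + k.2 ≤ D := by
  rw [indexPairs, Finset.mem_filter, Finset.mem_product, Finset.mem_range, Finset.mem_range]
  omega

/-- The numbers of rooted trees of height exactly `h`, and of smaller height, with `n` nodes and
at most `d` children at every node. -/
def treeCounts (d : ℕ) : ℕ → (ℕ → ℕ) × (ℕ → ℕ)
  | 0 => (fun n => if n = 1 then 1 else 0, fun _ => 0)
  | h + 1 =>
    (fun n => if n = 0 then 0 else
      mixedCount (treeCounts d h).1 (treeCounts d h).2 (indexPairs 1 d) (n - 1),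
    fun n => if n = 0 then 0 else
      mixedCount (treeCounts d h).1 (treeCounts d h).2 ({0} ×ˢ Finset.range (d + 1)) (n - 1))

namespace RTree

theorem size_pos : ∀ {h : ℕ} (x : RTree h), 0 < x.size
  | 0, _ => Nat.one_pos
  | _ + 1, _ => by
    rw [size]
    omega

theorem size_node {h : ℕ} (s : Multiset (RTree h)) : (node s).size = 1 + (s.map size).sum := by
  rw [size, branches_node]

theorem IsFull.lt_size : ∀ {h : ℕ} {x : RTree h}, x.IsFull → h < x.size
  | 0, x, _ => x.size_pos
  | h + 1, x, ⟨y, hy, hy'⟩ => by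
    have h1 := IsFull.lt_size hy'
    have h2 := Multiset.single_le_sum (fun _ _ => Nat.zero_le _) _
      (Multiset.mem_map_of_mem size hy)
    rw [size]
    omega

theorem mem_mixed_iff {d h n : ℕ} {s : Multiset (RTree h)} {I : Finset (ℕ × ℕ)}
    [DecidablePred (IsFull (h := h))] [DecidablePred fun x : RTree h => ¬ x.IsFull] :
    s ∈ mixed size (fun x => x.IsAry d ∧ x.IsFull) (fun x => x.IsAry d ∧ ¬ x.IsFull) I n ↔
      (∀ x ∈ s, x.IsAry d) ∧ ((s.filter IsFull).card, (s.filter fun x => ¬ x.IsFull).card) ∈ I ∧ (s.map size).sum = n := by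
  have : DecidablePred fun x : RTree h => x.IsAry d ∧ x.IsFull := Classical.decPred _
  have : DecidablePred fun x : RTree h => x.IsAry d ∧ ¬ x.IsFull := Classical.decPred _
  have h1 : (∀ x ∈ s, x.IsAry d ∧ x.IsFull ∨ x.IsAry d ∧ ¬ x.IsFull) ↔ ∀ x ∈ s, x.IsAry d :=
    forall₂_congr fun x _ => by rw [← and_or_left, and_iff_left (em _)]
  rw [mem_mixed, h1]
  refine and_congr_right fun hs => and_congr_left fun _ => ?_
  rw [Multiset.filter_congr (q := IsFull) fun x hx => and_iff_right (hs x hx),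
    Multiset.filter_congr (q := fun x => ¬ x.IsFull) fun x hx => and_iff_right (hs x hx)]

theorem encard_isAry (d h n : ℕ) :
    {x : RTree h | (x.IsAry d ∧ x.IsFull) ∧ x.size = n}.encard = (treeCounts d h).1 n ∧
    {x : RTree h | (x.IsAry d ∧ ¬ x.IsFull) ∧ x.size = n}.encard = (treeCounts d h).2 n := by
  classical
  induction h generalizing n with
  | zero =>
    constructor
    · have : {x : RTree 0 | (x.IsAry d ∧ x.IsFull) ∧ x.size = n} =
          if n = 1 then {leaf} else ∅ := by
        ext x
        have h1 : x ∈ {x : RTree 0 | (x.IsAry d ∧ x.IsFull) ∧ x.size = n} ↔ 1 = n :=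
          and_iff_right ⟨trivial, trivial⟩
        rw [h1]
        split_ifs with h
        · exact iff_of_true h.symm rfl
        · exact iff_of_false (fun e => h e.symm) id
      rw [this, treeCounts]
      by_cases h : n = 1 <;> simp [h]
    · rw [treeCounts, Nat.cast_zero, Set.encard_eq_zero, Set.eq_empty_iff_forall_notMem]
      exact fun x hx => hx.1.2 trivial
  | succ h ih =>
    obtain _ | n := n
    · have h0 : ∀ P : RTree (h + 1) → Prop, {x | P x ∧ x.size = 0} = ∅ := fun P =>
        Set.eq_empty_of_forall_notMem fun x hx => x.size_pos.ne' hx.2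
      rw [h0, h0]
      simp [treeCounts]
    · have key : ∀ (P : RTree (h + 1) → Prop) (I : Finset (ℕ × ℕ)),
          (∀ s : Multiset (RTree h), (∀ x ∈ s, x.IsAry d) → ((s.card ≤ d ∧ P (node s)) ↔
            ((s.filter IsFull).card, (s.filter fun x => ¬ x.IsFull).card) ∈ I)) →
          {x : RTree (h + 1) | (x.IsAry d ∧ P x) ∧ x.size = n + 1}.encard =
            mixedCount (treeCounts d h).1 (treeCounts d h).2 I n := by
        intro P I hP
        rw [← encard_mixed_eq_mixedCount size size_pos (fun i => (ih i).1) (fun i => (ih i).2)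
          (fun x hx hx' => hx'.2 hx.2), ← node_injective.encard_image]
        congr 1
        ext x
        constructor
        · rintro ⟨⟨⟨h1, h2⟩, h3⟩, h4⟩
          refine ⟨x.branches, mem_mixed_iff.2 ⟨h2, (hP _ h2).1 ⟨h1, h3⟩, ?_⟩, rfl⟩
          rw [size] at h4
          omega
        · rintro ⟨s, hs, rfl⟩
          obtain ⟨h1, h2, h3⟩ := mem_mixed_iff.1 hs
          obtain ⟨h4, h5⟩ := (hP s h1).2 h2
          refine ⟨⟨⟨h4, h1⟩, h5⟩, ?_⟩
          rw [size_node, h3, add_comm]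
      have hcard : ∀ s : Multiset (RTree h), s.card =
          (s.filter IsFull).card + (s.filter fun x => ¬ x.IsFull).card := fun s => by
        rw [← Multiset.card_add, Multiset.filter_add_not]
      have hpos : ∀ s : Multiset (RTree h), (node s).IsFull ↔ 1 ≤ (s.filter IsFull).card := by
        intro s
        rw [isFull_node, Nat.one_le_iff_ne_zero, Ne, Multiset.card_eq_zero,
          Multiset.filter_eq_nil]
        push Not
        rfl
      constructor
      · rw [key _ (indexPairs 1 d), treeCounts]
        · rfl
        · intro s _
          rw [mem_indexPairs, ← hcard, hpos, and_comm]
      · rw [key _ ({0} ×ˢ Finset.range (d + 1)), treeCounts]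
        · rfl
        · intro s _
          rw [hcard, hpos, Finset.mem_product, Finset.mem_singleton, Finset.mem_range]
          simp only
          omega

end RTree

/-- The number of codes of central forests with `δ + 1` roots, depth `m` and `n` nodes. -/
def codeCount (d n : ℕ) : ℕ → ℕ → ℕ
  | 0, 0 => if n = 1 then 1 else 0
  | 0, m + 1 => if n = 0 then 0 else
      mixedCount (treeCounts d m).1 (treeCounts d m).2 (indexPairs 2 (d + 1)) (n - 1)
  | _ + 1, m => mixedCount (treeCounts d m).1 (treeCounts d m).2 {(2, 0)} n

open Classical in
theorem two_mul_lt_sum_size {m : ℕ} {s : Multiset (RTree m)}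
    (hs : 2 ≤ (s.filter RTree.IsFull).card) : 2 * m + 2 ≤ (s.map RTree.size).sum := by
  have h1 := Multiset.card_nsmul_le_sum (s := (s.filter RTree.IsFull).map RTree.size) (a := m + 1)
    (fun x hx => by
      obtain ⟨y, hy, rfl⟩ := Multiset.mem_map.1 hx
      exact (Multiset.of_mem_filter hy).lt_size)
  have h2 := congrArg (fun t => (t.map RTree.size).sum) (Multiset.filter_add_not RTree.IsFull s)
  simp only [Multiset.map_add, Multiset.sum_add] at h2
  rw [Multiset.card_map, smul_eq_mul] at h1
  have := Nat.mul_le_mul_right (m + 1) hs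
  omega

theorem lt_sum_size_of_mem_centralCodes {d δ m : ℕ} {z : Multiset (RTree m)}
    (hz : z ∈ centralCodes d δ m) : 2 * m < (z.map RTree.size).sum := by
  match δ, m, z, hz with
  | 0, 0, z, hz =>
    obtain rfl : z = {RTree.leaf} := hz
    exact Nat.one_pos
  | 0, m + 1, z, ⟨s, hs, _, _, h⟩ =>
    subst hs
    have := two_mul_lt_sum_size h
    rw [Multiset.map_singleton, Multiset.sum_singleton, RTree.size_node]
    omega
  | _ + 1, m, z, ⟨_, _, h⟩ =>
    have := two_mul_lt_sum_size h
    omega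

theorem encard_centralCodes (d δ m n : ℕ) :
    {z | z ∈ centralCodes d δ m ∧ (z.map RTree.size).sum = n}.encard = codeCount d n δ m := by
  classical
  have key := fun m I n => encard_mixed_eq_mixedCount RTree.size RTree.size_pos
    (fun i => (RTree.encard_isAry d m i).1) (fun i => (RTree.encard_isAry d m i).2)
    (fun x hx hx' => hx'.2 hx.2) I n
  have hcard : ∀ {m} (s : Multiset (RTree m)), s.card =
      (s.filter RTree.IsFull).card + (s.filter fun x => ¬ x.IsFull).card := fun s => by
    rw [← Multiset.card_add, Multiset.filter_add_not]
  match δ, m with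
  | 0, 0 =>
    have : {z | z ∈ centralCodes d 0 0 ∧ (z.map RTree.size).sum = n} =
        if n = 1 then {{RTree.leaf}} else ∅ := by
      ext z
      constructor
      · rintro ⟨h1, rfl⟩
        obtain rfl : z = {RTree.leaf} := h1
        rfl
      · by_cases h : n = 1
        · rw [if_pos h]
          rintro rfl
          exact ⟨rfl, h.symm⟩
        · rw [if_neg h]
          exact False.elim
    rw [this, codeCount]
    by_cases h : n = 1 <;> simp [h]
  | 0, m + 1 =>
    obtain _ | n := n
    · rw [codeCount, if_pos rfl, Nat.cast_zero, Set.encard_eq_zero,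
        Set.eq_empty_iff_forall_notMem]
      rintro z ⟨h1, h2⟩
      have := lt_sum_size_of_mem_centralCodes h1
      omega
    · rw [codeCount, if_neg n.succ_ne_zero, Nat.add_sub_cancel, ← key,
        ← (show Function.Injective fun s : Multiset (RTree m) => ({RTree.node s} : Multiset _) from
          fun s t h => RTree.node_injective (Multiset.singleton_inj.1 h)).encard_image]
      congr 1
      ext z
      constructor
      · rintro ⟨⟨s, rfl, h1, h2, h3⟩, h4⟩
        rw [Multiset.map_singleton, Multiset.sum_singleton, RTree.size_node] at h4
        rw [hcard] at h1
        exact ⟨s, RTree.mem_mixed_iff.2 ⟨h2, mem_indexPairs.2 ⟨h3, h1⟩, by omega⟩, rfl⟩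
      · rintro ⟨s, hs, rfl⟩
        obtain ⟨h1, h2, h3⟩ := RTree.mem_mixed_iff.1 hs
        obtain ⟨h4, h5⟩ := mem_indexPairs.1 h2
        refine ⟨⟨s, rfl, ?_, h1, h4⟩, ?_⟩
        · rw [hcard]
          exact h5
        · rw [Multiset.map_singleton, Multiset.sum_singleton, RTree.size_node, h3, add_comm]
  | δ + 1, m =>
    rw [codeCount, ← key]
    congr 1
    ext z
    rw [RTree.mem_mixed_iff, Finset.mem_singleton, Prod.mk.injEq]
    have h1 := hcard z
    constructor
    · rintro ⟨⟨h2, h3, h4⟩, h5⟩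
      exact ⟨h3, ⟨by omega, by omega⟩, h5⟩
    · rintro ⟨h2, ⟨h3, h4⟩, h5⟩
      exact ⟨⟨by omega, h2, h3.ge⟩, h5⟩

theorem ncard_codes (d δ : ℕ) {n M : ℕ} (hM : n ≤ 2 * M) :
    (codes d δ n).ncard = ∑ m ∈ Finset.range M, codeCount d n δ m := by
  have h1 : codes d δ n = ⋃ m ∈ Finset.range M, Sigma.mk m ''
      {z | z ∈ centralCodes d δ m ∧ (z.map RTree.size).sum = n} := by
    ext ⟨m, z⟩
    simp only [Set.mem_iUnion, exists_prop, Finset.mem_range]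
    constructor
    · rintro ⟨h1, h2⟩
      have := lt_sum_size_of_mem_centralCodes h1
      simp only at h2 this
      exact ⟨m, by omega, z, ⟨h1, h2⟩, rfl⟩
    · rintro ⟨m', -, z', h, e⟩
      cases e
      exact h
  rw [Set.ncard, h1, encard_biUnion_finset]
  · simp only [sigma_mk_injective.encard_image, encard_centralCodes]
    rw [← Nat.cast_sum, ENat.toNat_natCast]
  · intro m _ m' _ hne
    refine Set.disjoint_left.2 ?_
    rintro _ ⟨z, -, rfl⟩ ⟨z', -, e⟩
    exact hne (congrArg Sigma.fst e).symm

end AlkaneCount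

namespace AlkaneCount

/-! ### Polynomial arithmetic on lists of coefficients -/

/-- The coefficient of `X ^ n`. -/
def coeff (p : List ℕ) (n : ℕ) : ℕ := p.getD n 0

/-- Addition of polynomials. -/
def polyAdd : List ℕ → List ℕ → List ℕ
  | [], q => q
  | a :: p, [] => a :: p
  | a :: p, b :: q => (a + b) :: polyAdd p q

/-- Multiplication of a polynomial by a constant. -/
def polyScale (c : ℕ) (p : List ℕ) : List ℕ := p.map (c * ·)

/-- Multiplication of a polynomial by `X ^ j`. -/
def polyShift : ℕ → List ℕ → List ℕ
  | 0, p => p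
  | j + 1, p => 0 :: polyShift j p

/-- Multiplication of polynomials. -/
def polyMul : List ℕ → List ℕ → List ℕ
  | [], _ => []
  | a :: p, q => polyAdd (polyScale a q) (0 :: polyMul p q)

/-- The sum of the polynomials `f 0, …, f (n - 1)`. -/
def polySum (f : ℕ → List ℕ) : ℕ → List ℕ
  | 0 => []
  | n + 1 => polyAdd (polySum f n) (f n)

@[simp] theorem coeff_nil (n : ℕ) : coeff [] n = 0 := rfl

@[simp] theorem coeff_cons_zero (a : ℕ) (p : List ℕ) : coeff (a :: p) 0 = a := rfl

@[simp] theorem coeff_cons_succ (a : ℕ) (p : List ℕ) (n : ℕ) :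
    coeff (a :: p) (n + 1) = coeff p n := rfl

theorem coeff_take {p : List ℕ} {n N : ℕ} (h : n < N) : coeff (p.take N) n = coeff p n := by
  simp [coeff, List.getD_eq_getElem?_getD, h]

theorem coeff_polyAdd (p q : List ℕ) (n : ℕ) : coeff (polyAdd p q) n = coeff p n + coeff q n := by
  induction p generalizing q n with
  | nil => simp [polyAdd]
  | cons a p ih =>
    obtain _ | ⟨b, q⟩ := q
    · simp [polyAdd]
    · obtain _ | n := n
      · simp [polyAdd]
      · simpa [polyAdd] using ih q n

theorem coeff_polyScale (c : ℕ) (p : List ℕ) (n : ℕ) :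
    coeff (polyScale c p) n = c * coeff p n := by
  induction p generalizing n with
  | nil => simp [polyScale]
  | cons a p ih =>
    obtain _ | n := n
    · simp [polyScale]
    · exact ih n

theorem coeff_polyShift (j : ℕ) (p : List ℕ) (n : ℕ) :
    coeff (polyShift j p) n = if j ≤ n then coeff p (n - j) else 0 := by
  induction j generalizing n with
  | zero => simp [polyShift]
  | succ j ih =>
    obtain _ | n := n
    · simp [polyShift]
    · simp [polyShift, ih]

theorem coeff_polyMul (p q : List ℕ) (n : ℕ) : coeff (polyMul p q) n =
    ∑ ab ∈ Finset.HasAntidiagonal.antidiagonal n, coeff p ab.1 * coeff q ab.2 := by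
  induction p generalizing n with
  | nil => simp [polyMul]
  | cons a p ih =>
    rw [polyMul, coeff_polyAdd, coeff_polyScale]
    obtain _ | n := n
    · simp
    · rw [coeff_cons_succ, ih, Finset.Nat.sum_antidiagonal_succ]
      simp

theorem coeff_polySum (f : ℕ → List ℕ) (m n : ℕ) :
    coeff (polySum f m) n = ∑ i ∈ Finset.range m, coeff (f i) n := by
  induction m with
  | zero => rfl
  | succ m ih => rw [polySum, coeff_polyAdd, ih, Finset.sum_range_succ]

/-! ### Evaluation of the counts -/

/-- The row of the counts of multisets with `k` elements. -/
def row (T : List (List ℕ)) (k : ℕ) : List ℕ := T.getD k []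

/-- The rows `k ≤ K` of `multisetCount a j k n`, for `n < N`, where `l` lists the values of `a`. -/
def multisetTable (K N : ℕ) (l : List ℕ) : ℕ → List (List ℕ)
  | 0 => [[1]]
  | j + 1 =>
    let T := multisetTable K N l j
    (List.range (K + 1)).map fun k => (polySum (fun i => polyShift (i * (j + 1))
      (polyScale ((coeff l (j + 1)).ascFactorial i / i.factorial) (row T (k - i))))
      (min (k + 1) (N / (j + 1) + 1))).take N

/-- The list of the values of `mixedCount`, from the two tables of counts of multisets. -/
def mixedTable (N : ℕ) (S T : List (List ℕ)) (I : List (ℕ × ℕ)) : List ℕ :=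
  (I.foldr (fun k p => polyAdd (polyMul (row S k.1) (row T k.2)) p) []).take N

theorem coeff_row_multisetTable {K N : ℕ} {l : List ℕ} {a : ℕ → ℕ}
    (hl : ∀ n < N, coeff l n = a n) {j k n : ℕ} (hj : j < N) (hk : k ≤ K) (hn : n < N) :
    coeff (row (multisetTable K N l j) k) n = multisetCount a j k n := by
  induction j generalizing k n with
  | zero => obtain _ | k := k <;> obtain _ | n := n <;> simp [multisetTable, row, multisetCount]
  | succ j ih =>
    have h1 : row (multisetTable K N l (j + 1)) k = (polySum (fun i => polyShift (i * (j + 1))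
        (polyScale ((coeff l (j + 1)).ascFactorial i / i.factorial)
          (row (multisetTable K N l j) (k - i)))) (min (k + 1) (N / (j + 1) + 1))).take N := by
      rw [row, multisetTable, List.getD_eq_getElem?_getD, List.getElem?_map,
        List.getElem?_range (by omega)]
      rfl
    rw [h1, coeff_take hn, coeff_polySum, multisetCount,
      ← Finset.sum_subset (Finset.range_mono (min_le_left (k + 1) (N / (j + 1) + 1)))]
    swap
    · intro i h2 h3
      rw [Finset.mem_range] at h2 h3
      rw [if_neg]
      have : N < i * (j + 1) :=
        (Nat.div_lt_iff_lt_mul j.succ_pos).1 (show N / (j + 1) < i by omega)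
      omega
    refine Finset.sum_congr rfl fun i _ => ?_
    rw [coeff_polyShift]
    split_ifs with h
    · rw [coeff_polyScale, ih (by omega) (by omega) (by omega), hl _ hj, Nat.multichoose_eq,
        Nat.choose_eq_asc_factorial_div_factorial']
    · rfl

theorem multisetCount_eq_of_le (a : ℕ → ℕ) {j k n : ℕ} (h : n ≤ j) :
    multisetCount a j k n = multisetCount a n k n := by
  induction j, h using Nat.le_induction with
  | base => rfl
  | succ j hj ih =>
    rw [multisetCount, Finset.sum_eq_single 0]
    · simp [ih]
    · intro i _ hi
      rw [if_neg]
      have := Nat.mul_le_mul_right (j + 1) (Nat.one_le_iff_ne_zero.2 hi)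
      omega
    · simp

theorem multisetCount_eq (a : ℕ → ℕ) {j j' k n : ℕ} (h : n ≤ j) (h' : n ≤ j') :
    multisetCount a j k n = multisetCount a j' k n := by
  rw [multisetCount_eq_of_le a h, multisetCount_eq_of_le a h']

theorem coeff_mixedTable {K N : ℕ} {l l' : List ℕ} {f g : ℕ → ℕ}
    (hl : ∀ n ≤ N, coeff l n = f n) (hl' : ∀ n ≤ N, coeff l' n = g n) {I : List (ℕ × ℕ)}
    (hI : I.Nodup) (hK : ∀ k ∈ I, k.1 ≤ K ∧ k.2 ≤ K) {J : Finset (ℕ × ℕ)} (hJ : I.toFinset = J)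
    {n : ℕ} (hn : n ≤ N) :
    coeff (mixedTable (N + 1) (multisetTable K (N + 1) l N) (multisetTable K (N + 1) l' N) I) n =
      mixedCount f g J n := by
  subst hJ
  rw [mixedTable, coeff_take (by omega), mixedCount]
  induction I with
  | nil => simp
  | cons k I ih =>
    obtain ⟨h1, h2⟩ := List.nodup_cons.1 hI
    rw [List.foldr_cons, coeff_polyAdd, ih h2 fun k hk => hK k (List.mem_cons_of_mem _ hk),
      List.toFinset_cons, Finset.sum_insert (by rwa [List.mem_toFinset]), coeff_polyMul]
    congr 1
    obtain ⟨hk1, hk2⟩ := hK k List.mem_cons_self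
    refine Finset.sum_congr rfl fun ab hab => ?_
    rw [Finset.HasAntidiagonal.mem_antidiagonal] at hab
    rw [coeff_row_multisetTable (a := f) (fun n hn => hl n (by omega)) (by omega) hk1 (by omega),
      coeff_row_multisetTable (a := g) (fun n hn => hl' n (by omega)) (by omega) hk2 (by omega),
      multisetCount_eq f (j := N) (j' := n) (by omega) (by omega),
      multisetCount_eq g (j := N) (j' := n) (by omega) (by omega)]

/-- The lists of the values of `(treeCounts 3 h).1` and `(treeCounts 3 h).2` up to `22`. -/
def treeTables : ℕ → List ℕ × List ℕ
  | 0 => ([0, 1], [])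
  | h + 1 =>
    let S := multisetTable 4 23 (treeTables h).1 22
    let T := multisetTable 4 23 (treeTables h).2 22
    (0 :: mixedTable 23 S T [(1, 0), (1, 1), (1, 2), (2, 0), (2, 1), (3, 0)],
      0 :: mixedTable 23 S T [(0, 0), (0, 1), (0, 2), (0, 3)])

theorem coeff_treeTables (h : ℕ) : (∀ n ≤ 22, coeff (treeTables h).1 n = (treeCounts 3 h).1 n) ∧
    ∀ n ≤ 22, coeff (treeTables h).2 n = (treeCounts 3 h).2 n := by
  induction h with
  | zero =>
    constructor
    · rintro (_ | _ | n) _ <;> simp [treeTables, treeCounts]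
    · intro n _
      rfl
  | succ h ih =>
    constructor
    · rintro (_ | n) hn
      · rw [treeTables, coeff_cons_zero, treeCounts]
        rfl
      · rw [treeTables, coeff_cons_succ, coeff_mixedTable ih.1 ih.2 (by decide) (by decide)
          (J := indexPairs 1 3) (by decide) (by omega)]
        rfl
    · rintro (_ | n) hn
      · rw [treeTables, coeff_cons_zero, treeCounts]
        rfl
      · rw [treeTables, coeff_cons_succ, coeff_mixedTable ih.1 ih.2 (by decide) (by decide)
          (J := {0} ×ˢ Finset.range (3 + 1)) (by decide) (by omega)]
        rfl

/-- The list of the values of `mixedCount` for the two sorts of rooted trees of height at most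
`h`. -/
def codeTable (I : List (ℕ × ℕ)) (h : ℕ) : List ℕ :=
  mixedTable 23 (multisetTable 4 23 (treeTables h).1 22) (multisetTable 4 23 (treeTables h).2 22) I

/-- The numbers of centered 4-valent trees with at most 22 nodes. -/
def centeredTable : List ℕ :=
  (0 :: polyAdd [1] (polySum (codeTable [(2, 0), (2, 1), (2, 2), (3, 0), (3, 1), (4, 0)]) 10)).take
    23

/-- The numbers of bicentered 4-valent trees with at most 22 nodes. -/
def bicenteredTable : List ℕ := (polySum (codeTable [(2, 0)]) 11).take 23

theorem numCentered_eq_coeff {n : ℕ} (hn : n ≤ 22) :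
    numCentered 4 n = coeff centeredTable n := by
  rw [numCentered_eq 3, ncard_codes 3 0 (M := 10 + 1) (by omega), Finset.sum_range_succ',
    centeredTable, coeff_take (by omega)]
  obtain _ | n := n
  · simp [codeCount]
  · rw [coeff_cons_succ, coeff_polyAdd, coeff_polySum, add_comm]
    refine congrArg₂ (· + ·) ?_ ?_
    · obtain _ | n := n <;> simp [codeCount]
    · refine Finset.sum_congr rfl fun m _ => ?_
      rw [codeTable, coeff_mixedTable (coeff_treeTables m).1 (coeff_treeTables m).2 (by decide)
        (by decide) (J := indexPairs 2 (3 + 1)) (by decide) (by omega)]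
      rfl

theorem numBicentered_eq_coeff {n : ℕ} (hn : n ≤ 22) :
    numBicentered 4 n = coeff bicenteredTable n := by
  rw [numBicentered_eq 3, ncard_codes 3 1 (M := 11) (by omega), bicenteredTable,
    coeff_take (by omega), coeff_polySum]
  refine Finset.sum_congr rfl fun m _ => ?_
  rw [codeTable, coeff_mixedTable (coeff_treeTables m).1 (coeff_treeTables m).2 (by decide)
    (by decide) (J := {(2, 0)}) (by decide) (by omega)]
  rfl

theorem tables_eq : (centeredTable, bicenteredTable) =
    ([0, 1, 0, 1, 1, 2, 2, 6, 9, 20, 37, 86, 181, 422, 943, 2223, 5225, 12613, 30513, 74883,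
        184484, 458561, 1145406],
    [0, 0, 1, 0, 1, 1, 3, 3, 9, 15, 38, 73, 174, 380, 915, 2124, 5134, 12281, 30010, 73401,
        181835, 452165, 1133252]) := by
  decide +kernel

end AlkaneCount

theorem mainTheorem3 :
    -- the table for `n = 1, …, 22`
    (List.range' 1 22).map (AlkaneCount.numCentered 4) =
      [1, 0, 1, 1, 2, 2, 6, 9, 20, 37, 86, 181, 422, 943, 2223, 5225, 12613, 30513, 74883,
        184484, 458561, 1145406] ∧
    (List.range' 1 22).map (AlkaneCount.numBicentered 4) =
      [0, 1, 0, 1, 1, 3, 3, 9, 15, 38, 73, 174, 380, 915, 2124, 5134, 12281, 30010, 73401,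
        181835, 452165, 1133252] ∧
    (List.range' 1 22).map (AlkaneCount.numTrees 4) =
      [1, 1, 1, 2, 3, 5, 9, 18, 35, 75, 159, 355, 802, 1858, 4347, 10359, 24894, 60523, 148284,
        366319, 910726, 2278658] ∧
    -- Cayley's entries for `n = 1, …, 13`: exactly those for `n = 12, 13` are wrong in the
    -- centered and total rows, and his bicentered row is correct
    (∀ i : Fin 13, AlkaneCount.cayleyCentered.get i = AlkaneCount.numCentered 4 (i + 1) ↔
      (i : ℕ) + 1 ≠ 12 ∧ (i : ℕ) + 1 ≠ 13) ∧
    (∀ i : Fin 13,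
      AlkaneCount.cayleyBicentered.get i = AlkaneCount.numBicentered 4 (i + 1)) ∧
    (∀ i : Fin 13, AlkaneCount.cayleyTotal.get i = AlkaneCount.numTrees 4 (i + 1) ↔
      (i : ℕ) + 1 ≠ 12 ∧ (i : ℕ) + 1 ≠ 13) ∧
    -- the value of Henze and Blair for `n = 19` is wrong; the correct one is 148284
    AlkaneCount.henzeBlair19 ≠ AlkaneCount.numTrees 4 19 ∧
    AlkaneCount.numTrees 4 19 = 148284 := by 
  have hC : (List.range' 1 22).map (AlkaneCount.numCentered 4) =
      [1, 0, 1, 1, 2, 2, 6, 9, 20, 37, 86, 181, 422, 943, 2223, 5225, 12613, 30513, 74883,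
        184484, 458561, 1145406] := by
    rw [List.map_congr_left fun n hn => AlkaneCount.numCentered_eq_coeff (n := n) (by
      rw [List.mem_range'_1] at hn
      omega), (Prod.mk.inj AlkaneCount.tables_eq).1]
    rfl
  have hB : (List.range' 1 22).map (AlkaneCount.numBicentered 4) =
      [0, 1, 0, 1, 1, 3, 3, 9, 15, 38, 73, 174, 380, 915, 2124, 5134, 12281, 30010, 73401,
        181835, 452165, 1133252] := by
    rw [List.map_congr_left fun n hn => AlkaneCount.numBicentered_eq_coeff (n := n) (by
      rw [List.mem_range'_1] at hn
      omega), (Prod.mk.inj AlkaneCount.tables_eq).2]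
    rfl
  have hA : (List.range' 1 22).map (AlkaneCount.numTrees 4) =
      [1, 1, 1, 2, 3, 5, 9, 18, 35, 75, 159, 355, 802, 1858, 4347, 10359, 24894, 60523, 148284,
        366319, 910726, 2278658] := by
    have : (List.range' 1 22).map (AlkaneCount.numTrees 4) =
        List.zipWith (· + ·) ((List.range' 1 22).map (AlkaneCount.numCentered 4))
          ((List.range' 1 22).map (AlkaneCount.numBicentered 4)) := by
      rw [List.zipWith_map, List.zipWith_self]
      exact List.map_congr_left fun n _ => AlkaneCount.numTrees_eq 4 n
    rw [this, hC, hB]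
    rfl
  have entry : ∀ {f : ℕ → ℕ} {l : List ℕ}, (List.range' 1 22).map f = l → ∀ i < 22,
      f (i + 1) = l.getD i 0 := by
    rintro f l rfl i hi
    simp [List.getD_eq_getElem?_getD, hi, add_comm]
  refine ⟨hC, hB, hA, fun i => ?_, fun i => ?_, fun i => ?_, ?_, ?_⟩
  · rw [entry hC i (by omega)]
    fin_cases i <;> decide
  · rw [entry hB i (by omega)]
    fin_cases i <;> decide
  · rw [entry hA i (by omega)]
    fin_cases i <;> decide
  · rw [entry hA 18 (by omega)]
    decide
  · rw [entry hA 18 (by omega)]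
    rfl
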